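/- For $\rho\ge 0$ let $\mathcal A_\rho$ be the complex Banach space of pairs of sequences $z=(\xi,\eta)\in\mathbb C^{\mathbb Z}\times\mathbb C^{\mathbb Z}$ with $\|z\|_\rho=\sum_{j\in\mathbb Z}e^{\rho|j|}(|\xi_j|+|\eta_j|)<\infty$, let $B_\rho(r)$ be its open ball of radius $r$ centred at $0$, and let $\omega=-i\sum_j d\xi_j\wedge d\eta_j$. For a differentiable function $F$ the Hamiltonian vector field is $X_F=\big(-i\,\partial F/\partial\eta_j,\ i\,\partial F/\partial\xi_j\big)_{j\in\mathbb Z}$. For $j,\ell\in\mathbb Z^3$ put $\mathcal M(j,\ell)=j_1+j_2+j_3-\ell_1-\ell_2-\ell_3$ and $\Omega(j,\ell)=j_1^2+j_2^2+j_3^2-\ell_1^2-\ell_2^2-\ell_3^2$. Let $H=N+P$ be the Hamiltonian of the quintic Schrödinger equation $i\partial_tv+\partial_x^2v=|v|^4v$ on the circle in Fourier variables, $$N=\sum_{j\in\mathbb Z}j^2\xi_j\eta_j,\qquad P=\frac13\sum_{\mathcal M(j,\ell)=0}\xi_{j_1}\xi_{j_2}\xi_{j_3}\eta_{\ell_1}\eta_{\ell_2}\eta_{\ell_3},$$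 considered at the points of finite energy, i.e. those with $\sum_jj^2(|\xi_j|^2+|\eta_j|^2)<\infty$ (for $\rho>0$ these are all points of $\mathcal A_\rho$). **Proposition (NF).** For every $\rho\ge0$ there are $\varepsilon_0>0$ and a constant $C$ such that for every $0<\varepsilon\le\varepsilon_0$ there is a canonical change of variables $\tau$ from $B_\rho(\varepsilon)$ into $B_\rho(2\varepsilon)$ (a smooth diffeomorphism of $B_\rho(\varepsilon)$ onto an open subset of $B_\rho(2\varepsilon)$ whose derivative preserves $\omega$), mapping points of finite energy to points of finite energy, such that at every point of finite energy of $B_\rho(\varepsilon)$ $$H\circ\tau=N+Z_6+R_{10},$$ where 1. $Z_6$ is the resonant part of $P$, $\displaystyle Z_6=\frac13\sum_{\mathcal M(j,\ell)=0,\ \Omega(j,\ell)=0}\xi_{j_1}\xi_{j_2}\xi_{j_3}\eta_{\ell_1}\eta_{\ell_2}\eta_{\ell_3}$; 2. $R_{10}$ is a smooth function on $B_\rho(\varepsilon)$ whose Hamiltonian vector field takes values in $\mathcal A_\rho$ and satisfies $\|X_{R_{10}}(z)\|_\rho\le C\|z\|_\rho^9$ for all $z\in B_\rho(\varepsilon)$;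 3. $\|\tau(z)-z\|_\rho\le C\|z\|_\rho^2$ for all $z\in B_\rho(\varepsilon)$. -/

import Mathlib

open scoped ContDiff

noncomputable section

namespace QuinticNLS

/-- The pairs of complex sequences `(ξ, η)` indexed by `ℤ` with
`∑ j, e^{ρ|j|} (|ξ j| + |η j|) < ∞`, as a subspace of all pairs of sequences. -/
def phaseSubmodule (ρ : ℝ) : Submodule ℂ ((ℤ → ℂ) × (ℤ → ℂ)) where
  carrier := {z | Summable fun j : ℤ => Real.exp (ρ * |(j : ℝ)|) * (‖z.1 j‖ + ‖z.2 j‖)}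
  zero_mem' := by simp
  add_mem' := by
    intro a b ha hb
    refine Summable.of_nonneg_of_le (fun j => by positivity) (fun j => ?_) (ha.add hb)
    rw [← mul_add]
    have h1 : ‖(a + b).1 j‖ ≤ ‖a.1 j‖ + ‖b.1 j‖ := norm_add_le (a.1 j) (b.1 j)
    have h2 : ‖(a + b).2 j‖ ≤ ‖a.2 j‖ + ‖b.2 j‖ := norm_add_le (a.2 j) (b.2 j)
    exact mul_le_mul_of_nonneg_left (by linarith) (Real.exp_pos _).le
  smul_mem' := by
    intro c a ha
    refine (Summable.mul_left ‖c‖ ha).congr (fun j => ?_)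
    simp only [Prod.smul_fst, Prod.smul_snd, Pi.smul_apply, smul_eq_mul, norm_mul]
    ring

/-- The analytic phase space `𝒜_ρ`. It is a type of its own, so that its topology is the one of
its norm and not the topology of coordinatewise convergence. -/
def PhaseSpace (ρ : ℝ) : Type := phaseSubmodule ρ

namespace PhaseSpace

variable {ρ : ℝ}

instance : AddCommGroup (PhaseSpace ρ) := inferInstanceAs (AddCommGroup (phaseSubmodule ρ))

instance : Module ℂ (PhaseSpace ρ) := inferInstanceAs (Module ℂ (phaseSubmodule ρ))

/-- The coordinates `ξ j`. -/
def xi (z : PhaseSpace ρ) : ℤ → ℂ := z.1.1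

/-- The coordinates `η j`. -/
def eta (z : PhaseSpace ρ) : ℤ → ℂ := z.1.2

theorem summable_norm (z : PhaseSpace ρ) :
    Summable fun j : ℤ => Real.exp (ρ * |(j : ℝ)|) * (‖z.xi j‖ + ‖z.eta j‖) := z.2

theorem ext {z w : PhaseSpace ρ} (h1 : ∀ j, z.xi j = w.xi j) (h2 : ∀ j, z.eta j = w.eta j) :
    z = w :=
  Subtype.ext (Prod.ext (funext h1) (funext h2))

/-- `‖(ξ, η)‖_ρ = ∑ j, e^{ρ|j|} (|ξ j| + |η j|)`. -/
instance : Norm (PhaseSpace ρ) :=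
  ⟨fun z => ∑' j : ℤ, Real.exp (ρ * |(j : ℝ)|) * (‖z.xi j‖ + ‖z.eta j‖)⟩

theorem norm_def (z : PhaseSpace ρ) :
    ‖z‖ = ∑' j : ℤ, Real.exp (ρ * |(j : ℝ)|) * (‖z.xi j‖ + ‖z.eta j‖) := rfl

theorem normCore : NormedSpace.Core ℂ (PhaseSpace ρ) where
  norm_nonneg z := tsum_nonneg fun j => by positivity
  norm_smul c z := by
    rw [norm_def, norm_def, ← tsum_mul_left]
    refine tsum_congr fun j => ?_
    have h1 : (c • z).xi j = c * z.xi j := rfl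
    have h2 : (c • z).eta j = c * z.eta j := rfl
    rw [h1, h2, norm_mul, norm_mul]
    ring
  norm_triangle z w := by
    rw [norm_def, norm_def, norm_def, ← z.summable_norm.tsum_add w.summable_norm]
    refine (z + w).summable_norm.tsum_le_tsum (fun j => ?_)
      (z.summable_norm.add w.summable_norm)
    rw [← mul_add]
    have h1 : ‖(z + w).xi j‖ ≤ ‖z.xi j‖ + ‖w.xi j‖ := norm_add_le (z.xi j) (w.xi j)
    have h2 : ‖(z + w).eta j‖ ≤ ‖z.eta j‖ + ‖w.eta j‖ := norm_add_le (z.eta j) (w.eta j)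
    exact mul_le_mul_of_nonneg_left (by linarith) (Real.exp_pos _).le
  norm_eq_zero_iff z := by
    constructor
    · intro h
      have h0 := z.summable_norm.hasSum
      rw [← norm_def, h, hasSum_zero_iff_of_nonneg (fun j => by positivity)] at h0
      have key : ∀ j : ℤ, ‖z.xi j‖ = 0 ∧ ‖z.eta j‖ = 0 := by
        intro j
        have hj := congrFun h0 j
        have hpos := Real.exp_pos (ρ * |(j : ℝ)|)
        have hs : ‖z.xi j‖ + ‖z.eta j‖ = 0 := by
          rcases mul_eq_zero.1 hj with h' | h'
          · exact absurd h' hpos.ne'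
          · exact h'
        have a := norm_nonneg (z.xi j)
        have b := norm_nonneg (z.eta j)
        constructor <;> linarith
      exact ext (fun j => norm_eq_zero.1 (key j).1) (fun j => norm_eq_zero.1 (key j).2)
    · rintro rfl
      have h1 : ∀ j, (0 : PhaseSpace ρ).xi j = 0 := fun _ => rfl
      have h2 : ∀ j, (0 : PhaseSpace ρ).eta j = 0 := fun _ => rfl
      simp [norm_def, h1, h2]

instance : NormedAddCommGroup (PhaseSpace ρ) := NormedAddCommGroup.ofCore normCore

instance : NormedSpace ℂ (PhaseSpace ρ) := NormedSpace.ofCore normCore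

theorem single_mem (a b : ℂ) (j : ℤ) :
    ((Pi.single j a, Pi.single j b) : (ℤ → ℂ) × (ℤ → ℂ)) ∈ phaseSubmodule ρ := by
  refine summable_of_ne_finset_zero (s := {j}) (fun k hk => ?_)
  have hk' : k ≠ j := by simpa using hk
  simp [hk']

/-- The coordinate vector in the direction `ξ j`. -/
def xiVec (ρ : ℝ) (j : ℤ) : PhaseSpace ρ := ⟨(Pi.single j 1, Pi.single j 0), single_mem 1 0 j⟩

/-- The coordinate vector in the direction `η j`. -/
def etaVec (ρ : ℝ) (j : ℤ) : PhaseSpace ρ := ⟨(Pi.single j 0, Pi.single j 1), single_mem 0 1 j⟩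

end PhaseSpace

open PhaseSpace

variable {ρ : ℝ}

/-- `∑ j, j² (|ξ j|² + |η j|²) < ∞`: the functions `∑ ξ j e^{ijx}` and `∑ η j e^{-ijx}` are in the
Sobolev space `H¹`, so that the quadratic Hamiltonian `∑ j, j² ξ j η j` converges absolutely. -/
def FiniteEnergy (z : PhaseSpace ρ) : Prop :=
  Summable fun j : ℤ => (j : ℝ) ^ 2 * (‖z.xi j‖ ^ 2 + ‖z.eta j‖ ^ 2)

/-- For `ρ > 0` every point of the phase space has finite energy. -/
theorem finiteEnergy_of_pos (hρ : 0 < ρ) (z : PhaseSpace ρ) : FiniteEnergy z := by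
  refine Summable.of_nonneg_of_le (fun j => by positivity) (fun j => ?_)
    (z.summable_norm.mul_left (2 / ρ ^ 2 * ‖z‖))
  set s := ‖z.xi j‖ + ‖z.eta j‖ with hs
  have hs0 : 0 ≤ s := by positivity
  have h1 : ‖z.xi j‖ ^ 2 + ‖z.eta j‖ ^ 2 ≤ s ^ 2 := by
    have := mul_nonneg (norm_nonneg (z.xi j)) (norm_nonneg (z.eta j))
    rw [hs]
    nlinarith
  have h2 : (j : ℝ) ^ 2 ≤ 2 / ρ ^ 2 * Real.exp (ρ * |(j : ℝ)|) := by
    have h := Real.quadratic_le_exp_of_nonneg (x := ρ * |(j : ℝ)|) (by positivity)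
    have hsq : (ρ * |(j : ℝ)|) ^ 2 = ρ ^ 2 * (j : ℝ) ^ 2 := by rw [mul_pow, sq_abs]
    have hnn : 0 ≤ ρ * |(j : ℝ)| := by positivity
    have hr : 0 < ρ ^ 2 := by positivity
    rw [div_mul_eq_mul_div, le_div_iff₀ hr]
    nlinarith
  have h3 : Real.exp (ρ * |(j : ℝ)|) * s ≤ ‖z‖ :=
    z.summable_norm.le_tsum j (fun k _ => by positivity)
  have h4 : s ≤ ‖z‖ := by
    have : 1 ≤ Real.exp (ρ * |(j : ℝ)|) := Real.one_le_exp (by positivity)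
    nlinarith
  have hE := Real.exp_pos (ρ * |(j : ℝ)|)
  calc (j : ℝ) ^ 2 * (‖z.xi j‖ ^ 2 + ‖z.eta j‖ ^ 2)
      ≤ (2 / ρ ^ 2 * Real.exp (ρ * |(j : ℝ)|)) * (‖z‖ * s) := by
        gcongr
        exact h1.trans (by nlinarith)
    _ = 2 / ρ ^ 2 * ‖z‖ * (Real.exp (ρ * |(j : ℝ)|) * s) := by ring

/-- The symplectic form `-i ∑ j, dξ j ∧ dη j`. -/
def sympForm (u v : PhaseSpace ρ) : ℂ :=
  -Complex.I * ∑' j : ℤ, (u.xi j * v.eta j - u.eta j * v.xi j)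

/-- `X` is the Hamiltonian vector field of `F` on `U`, for the symplectic form above: it has values
in the phase space, its `ξ j`-component is `-i ∂F/∂η j` and its `η j`-component is `i ∂F/∂ξ j`. -/
def IsHamiltonianVectorField (F : PhaseSpace ρ → ℂ) (X : PhaseSpace ρ → PhaseSpace ρ)
    (U : Set (PhaseSpace ρ)) : Prop :=
  ∀ z ∈ U, ∀ j : ℤ,
    (X z).xi j = -Complex.I * fderiv ℂ F z (etaVec ρ j) ∧
    (X z).eta j = Complex.I * fderiv ℂ F z (xiVec ρ j)

/-- `τ` is a canonical change of variables from `U` into `V`: a homeomorphism from `U` onto an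
open subset of `V`, infinitely differentiable (over `ℂ`) together with its inverse, whose
derivative preserves the symplectic form. -/
structure IsCanonicalChange (τ : OpenPartialHomeomorph (PhaseSpace ρ) (PhaseSpace ρ))
    (U V : Set (PhaseSpace ρ)) : Prop where
  source_eq : τ.source = U
  target_subset : τ.target ⊆ V
  contDiffOn : ContDiffOn ℂ ∞ τ τ.source
  contDiffOn_symm : ContDiffOn ℂ ∞ τ.symm τ.target
  symplectic : ∀ z ∈ τ.source, ∀ u v : PhaseSpace ρ,
    sympForm (fderiv ℂ τ z u) (fderiv ℂ τ z v) = sympForm u v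

/-- The indices `(j, ℓ)`, with `j, ℓ ∈ ℤ³`, of the monomials of degree six. -/
abbrev SexticIndex : Type := (Fin 3 → ℤ) × (Fin 3 → ℤ)

/-- The momentum `j₁ + j₂ + j₃ - ℓ₁ - ℓ₂ - ℓ₃`. -/
def momentum (p : SexticIndex) : ℤ := ∑ i, p.1 i - ∑ i, p.2 i

/-- The divisor `j₁² + j₂² + j₃² - ℓ₁² - ℓ₂² - ℓ₃²`. -/
def divisor (p : SexticIndex) : ℤ := ∑ i, p.1 i ^ 2 - ∑ i, p.2 i ^ 2

/-- The indices of zero momentum. -/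
def zeroMomentum : Set SexticIndex := {p | momentum p = 0}

/-- The resonant indices: zero momentum and zero divisor. -/
def resonant : Set SexticIndex := {p | momentum p = 0 ∧ divisor p = 0}

/-- The monomial `ξ_{j₁} ξ_{j₂} ξ_{j₃} η_{ℓ₁} η_{ℓ₂} η_{ℓ₃}`. -/
def monomial (p : SexticIndex) (z : PhaseSpace ρ) : ℂ :=
  (∏ i, z.xi (p.1 i)) * ∏ i, z.eta (p.2 i)

/-- `N = ∑ j, j² ξ j η j`. -/
def hamN (z : PhaseSpace ρ) : ℂ := ∑' j : ℤ, (j : ℂ) ^ 2 * (z.xi j * z.eta j)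

/-- `P`, one third of the sum of all sextic monomials of zero momentum. -/
def hamP (z : PhaseSpace ρ) : ℂ := 1 / 3 * ∑' p : zeroMomentum, monomial p.1 z

/-- The Hamiltonian `H = N + P` of the quintic nonlinear Schrödinger equation
`i ∂ₜv + ∂ₓ²v = |v|⁴ v` on the circle, in Fourier variables. -/
def hamH (z : PhaseSpace ρ) : ℂ := hamN z + hamP z

/-- `Z₆`, one third of the sum of all resonant sextic monomials. -/
def hamZ6 (z : PhaseSpace ρ) : ℂ := 1 / 3 * ∑' p : resonant, monomial p.1 z

end QuinticNLS

end

/-!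
The change of variables is the implicit midpoint map of a Hamiltonian vector field `X`: the point
`z` is sent to `τ z = m + X(m) / 2`, where the midpoint `m` solves `z = m - X(m) / 2`. Such a map
is symplectic, exactly as the flow of `X` is: if `A` is the derivative of `X` at `m`, then `A` is
skew for the symplectic form (`symp_fderiv_sexticField`), so `1 + A / 2` and `1 - A / 2` are
commuting adjoints of each other, and `(1 + A / 2) (1 - A / 2)⁻¹`, the derivative of `τ`,
preserves the form. It is a diffeomorphism near `0` because `m ↦ m ± X(m) / 2` are small Lipschitz
perturbations of the identity (`exists_midpointMap`); no differential equation has to be solved.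

The Hamiltonian `N` is quadratic, so `N(τ z) - N(z)` is exactly the derivative of `N` at `m` in
the direction `X(m)` (`hamN_sub_hamN`). For `X` the vector field of the sextic Hamiltonian `χ`
with coefficients `i / (3 Ω)` at the nonresonant indices, this derivative is `Z₆(m) - P(m)`
(`tsum_pairing_sexticField_coeffChi`). Hence `H(τ z) = N(z) + Z₆(z) + R(z)` with `R(z) = (Z₆(m) -
Z₆(z)) + (P(τ z) - P(m))`. As `m - z` and `τ z - m` are of order five, and `A` is of order four,
the vector field of `R` is of order nine. That it takes values in the phase space uses the
adjoints above once more: the derivative of `Z₆(m) - P(m)` with respect to `z` is represented by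
`(1 + A / 2)⁻¹` applied to a vector of the phase space (`exists_remainder_vector`).

All bounds on sextic Hamiltonians come from one convolution estimate, `tsum_prod_erase_le`: the
momentum condition determines each integer of an index from the five others. For `ρ = 0` the
Hamiltonian `N` is unbounded, and finite energy has to be propagated from `z` to `m`. The vector
field `X` is bounded for the energy (`energy_sexticField_le`), so the contraction that defines `m`
preserves a set on which the energy is bounded, and this set is closed (`isClosed_energy_le`). The
same transfer of derivatives between slots makes the series for the derivative of `N` along `X`
absolutely convergent (`tsum_sq_mul_monomial_ne_top`).
-/

noncomputable section

namespace QuinticNLS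

open PhaseSpace Finset
open scoped ENNReal

variable {ρ : ℝ}

/-! ### The phase space: weights, coordinates, completeness -/

/-- The weight `e^{ρ|j|}`, as an extended nonnegative real. -/
def weight (ρ : ℝ) (j : ℤ) : ℝ≥0∞ := ENNReal.ofReal (Real.exp (ρ * |(j : ℝ)|))

theorem one_le_weight (hρ : 0 ≤ ρ) (j : ℤ) : 1 ≤ weight ρ j := by
  rw [weight, ENNReal.one_le_ofReal]
  exact Real.one_le_exp (by positivity)

theorem enorm_eq_tsum (z : PhaseSpace ρ) :
    ‖z‖ₑ = ∑' j, weight ρ j * (‖z.xi j‖ₑ + ‖z.eta j‖ₑ) := by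
  rw [← ofReal_norm, norm_def, ENNReal.ofReal_tsum_of_nonneg (fun j => by positivity)
    z.summable_norm]
  refine tsum_congr fun j => ?_
  rw [ENNReal.ofReal_mul (Real.exp_pos _).le, ENNReal.ofReal_add (norm_nonneg _) (norm_nonneg _),
    ofReal_norm, ofReal_norm, weight]

theorem exists_of_tsum_ne_top (x y : ℤ → ℂ)
    (h : ∑' j, weight ρ j * (‖x j‖ₑ + ‖y j‖ₑ) ≠ ⊤) :
    ∃ z : PhaseSpace ρ, z.xi = x ∧ z.eta = y := by
  have hs : Summable fun j : ℤ => Real.exp (ρ * |(j : ℝ)|) * (‖x j‖ + ‖y j‖) := by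
    refine (ENNReal.summable_toReal h).congr fun j => ?_
    rw [ENNReal.toReal_mul, ENNReal.toReal_add (by simp) (by simp), toReal_enorm, toReal_enorm,
      weight, ENNReal.toReal_ofReal (Real.exp_pos _).le]
  exact ⟨⟨(x, y), hs⟩, rfl, rfl⟩

theorem xi_add (z w : PhaseSpace ρ) (j : ℤ) : (z + w).xi j = z.xi j + w.xi j := rfl
theorem eta_add (z w : PhaseSpace ρ) (j : ℤ) : (z + w).eta j = z.eta j + w.eta j := rfl
theorem xi_smul (c : ℂ) (z : PhaseSpace ρ) (j : ℤ) : (c • z).xi j = c * z.xi j := rfl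
theorem eta_smul (c : ℂ) (z : PhaseSpace ρ) (j : ℤ) : (c • z).eta j = c * z.eta j := rfl
theorem xi_sub (z w : PhaseSpace ρ) (j : ℤ) : (z - w).xi j = z.xi j - w.xi j := rfl
theorem eta_sub (z w : PhaseSpace ρ) (j : ℤ) : (z - w).eta j = z.eta j - w.eta j := rfl

/-- The six slots of a sextic monomial: three for the variables `ξ`, three for the variables
`η`. -/
abbrev Slot : Type := Fin 3 ⊕ Fin 3

/-- The coordinate attached to a slot: `ξ j` for the slots on the left, `η j` for those on the
right. -/
def coordLM (ρ : ℝ) (s : Slot) (j : ℤ) : PhaseSpace ρ →ₗ[ℂ] ℂ where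
  toFun z := s.elim (fun _ => z.xi j) (fun _ => z.eta j)
  map_add' z w := by cases s <;> rfl
  map_smul' c z := by cases s <;> rfl

theorem weight_mul_coordLM_le (s : Slot) (j : ℤ) (z : PhaseSpace ρ) :
    weight ρ j * ‖coordLM ρ s j z‖ₑ ≤ weight ρ j * (‖z.xi j‖ₑ + ‖z.eta j‖ₑ) := by
  gcongr
  rcases s with s | s
  · exact le_self_add
  · exact le_add_self

/-- The coordinate attached to a slot, as a continuous functional. -/
def coord (ρ : ℝ) (s : Slot) (j : ℤ) : PhaseSpace ρ →L[ℂ] ℂ :=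
  (coordLM ρ s j).mkContinuous (Real.exp (ρ * |(j : ℝ)|))⁻¹ fun z => by
    have h : weight ρ j * ‖coordLM ρ s j z‖ₑ ≤ ‖z‖ₑ := by
      rw [enorm_eq_tsum]
      exact (weight_mul_coordLM_le s j z).trans
        (ENNReal.le_tsum (f := fun j => weight ρ j * (‖z.xi j‖ₑ + ‖z.eta j‖ₑ)) j)
    rw [← ofReal_norm, ← ofReal_norm, weight, ← ENNReal.ofReal_mul (Real.exp_pos _).le,
      ENNReal.ofReal_le_ofReal_iff (norm_nonneg _)] at h
    rwa [inv_mul_eq_div, le_div_iff₀' (Real.exp_pos _)]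

@[simp] theorem coord_inl (i : Fin 3) (j : ℤ) (z : PhaseSpace ρ) :
    coord ρ (Sum.inl i) j z = z.xi j := rfl

@[simp] theorem coord_inr (i : Fin 3) (j : ℤ) (z : PhaseSpace ρ) :
    coord ρ (Sum.inr i) j z = z.eta j := rfl

theorem tsum_weight_mul_coord_le (s : Slot) (z : PhaseSpace ρ) :
    ∑' j, weight ρ j * ‖coord ρ s j z‖ₑ ≤ ‖z‖ₑ := by
  rw [enorm_eq_tsum]
  exact ENNReal.tsum_le_tsum fun j => weight_mul_coordLM_le s j z

theorem tsum_coord_le (hρ : 0 ≤ ρ) (s : Slot) (z : PhaseSpace ρ) :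
    ∑' j, ‖coord ρ s j z‖ₑ ≤ ‖z‖ₑ :=
  (ENNReal.tsum_le_tsum fun j => le_mul_of_one_le_left' (one_le_weight hρ j)).trans
    (tsum_weight_mul_coord_le s z)

theorem coord_le (hρ : 0 ≤ ρ) (s : Slot) (j : ℤ) (z : PhaseSpace ρ) :
    ‖coord ρ s j z‖ₑ ≤ ‖z‖ₑ :=
  (ENNReal.le_tsum (f := fun j => ‖coord ρ s j z‖ₑ) j).trans (tsum_coord_le hρ s z)

instance : CompleteSpace (PhaseSpace ρ) := by
  refine NormedAddCommGroup.completeSpace_of_summable_imp_tendsto fun u hu => ?_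
  have hu' : ∑' n, ‖u n‖ₑ ≠ ⊤ := tsum_enorm_ne_top_iff_summable_norm.2 hu
  have hus : ∀ (s : Slot) (j : ℤ), Summable fun n => coord ρ s j (u n) := fun s j =>
    Summable.of_norm_bounded (hu.mul_left ‖coord ρ s j‖) fun n => (coord ρ s j).le_opNorm _
  -- the coordinatewise sum `z` of the series has tails of norm at most `∑' n, ‖u (n + N)‖`
  have key : ∀ v : ℕ → PhaseSpace ρ, ∑' j, weight ρ j *
      (‖∑' n, (v n).xi j‖ₑ + ‖∑' n, (v n).eta j‖ₑ) ≤ ∑' n, ‖v n‖ₑ := fun v => by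
    simp_rw [enorm_eq_tsum]
    rw [ENNReal.tsum_comm]
    refine ENNReal.tsum_le_tsum fun j => ?_
    rw [ENNReal.tsum_mul_left, ENNReal.tsum_add]
    gcongr <;> exact enorm_tsum_le_tsum_enorm
  obtain ⟨z, hx, hy⟩ := exists_of_tsum_ne_top (ρ := ρ) (fun j => ∑' n, (u n).xi j)
    (fun j => ∑' n, (u n).eta j) (ne_top_of_le_ne_top hu' (key u))
  refine ⟨z, ?_⟩
  rw [tendsto_iff_edist_tendsto_0]
  have htail := ENNReal.tendsto_sum_nat_add (fun n => ‖u n‖ₑ) hu'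
  refine tendsto_of_tendsto_of_tendsto_of_le_of_le tendsto_const_nhds htail
    (fun _ => zero_le) fun N => ?_
  have hc : ∀ (s : Slot) (j : ℤ),
      coord ρ s j (z - ∑ i ∈ range N, u i) = ∑' n, coord ρ s j (u (n + N)) := fun s j => by
    have hz : coord ρ s j z = ∑' n, coord ρ s j (u n) := by
      rcases s with s | s
      · exact congrFun hx j
      · exact congrFun hy j
    rw [map_sub, map_sum, hz, ← (hus s j).sum_add_tsum_nat_add N, add_sub_cancel_left]
  show edist (∑ i ∈ range N, u i) z ≤ _
  rw [edist_comm, edist_eq_enorm_sub, enorm_eq_tsum]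
  refine le_trans (le_of_eq (tsum_congr fun j => ?_)) (key fun n => u (n + N))
  have h1 := hc (Sum.inl 0) j
  have h2 := hc (Sum.inr 0) j
  simp only [coord_inl, coord_inr] at h1 h2
  rw [h1, h2]

/-! ### The symplectic form -/

theorem summable_mul_of_phaseSpace (hρ : 0 ≤ ρ) (s t : Slot) (u v : PhaseSpace ρ) :
    Summable fun j => coord ρ s j u * coord ρ t j v := by
  refine Summable.of_enorm (ne_top_of_le_ne_top (b := ‖u‖ₑ * ‖v‖ₑ)
    (ENNReal.mul_ne_top (by simp) (by simp)) ?_)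
  calc ∑' j, ‖coord ρ s j u * coord ρ t j v‖ₑ ≤ ∑' j, ‖u‖ₑ * ‖coord ρ t j v‖ₑ :=
        ENNReal.tsum_le_tsum fun j => by
          rw [enorm_mul]
          gcongr
          exact coord_le hρ s j u
    _ ≤ _ := by
        rw [ENNReal.tsum_mul_left]
        gcongr
        exact tsum_coord_le hρ t v

theorem summable_symp (hρ : 0 ≤ ρ) (u v : PhaseSpace ρ) :
    Summable fun j : ℤ => u.xi j * v.eta j - u.eta j * v.xi j :=
  (summable_mul_of_phaseSpace hρ (Sum.inl 0) (Sum.inr 0) u v).sub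
    (summable_mul_of_phaseSpace hρ (Sum.inr 0) (Sum.inl 0) u v)

theorem norm_sympForm_le (hρ : 0 ≤ ρ) (u v : PhaseSpace ρ) :
    ‖sympForm u v‖ ≤ 1 * ‖u‖ * ‖v‖ := by
  have h : ‖sympForm u v‖ₑ ≤ ‖u‖ₑ * ‖v‖ₑ := by
    have hc : ∀ j, ‖u.xi j * v.eta j - u.eta j * v.xi j‖ₑ ≤
        ‖u‖ₑ * (weight ρ j * (‖v.xi j‖ₑ + ‖v.eta j‖ₑ)) := fun j => by
      calc _ ≤ ‖u.xi j * v.eta j‖ₑ + ‖u.eta j * v.xi j‖ₑ := enorm_sub_le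
        _ ≤ ‖u‖ₑ * ‖v.eta j‖ₑ + ‖u‖ₑ * ‖v.xi j‖ₑ := by
          rw [enorm_mul, enorm_mul]
          gcongr
          · exact coord_le hρ (Sum.inl 0) j u
          · exact coord_le hρ (Sum.inr 0) j u
        _ = ‖u‖ₑ * (‖v.xi j‖ₑ + ‖v.eta j‖ₑ) := by ring
        _ ≤ _ := by
          gcongr
          exact le_mul_of_one_le_left' (one_le_weight hρ j)
    calc ‖sympForm u v‖ₑ = ‖∑' j : ℤ, (u.xi j * v.eta j - u.eta j * v.xi j)‖ₑ := by
          rw [sympForm, enorm_mul]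
          simp [enorm_eq_nnnorm]
      _ ≤ ∑' j, ‖u.xi j * v.eta j - u.eta j * v.xi j‖ₑ := enorm_tsum_le_tsum_enorm
      _ ≤ ∑' j, ‖u‖ₑ * (weight ρ j * (‖v.xi j‖ₑ + ‖v.eta j‖ₑ)) := ENNReal.tsum_le_tsum hc
      _ = _ := by rw [ENNReal.tsum_mul_left, ← enorm_eq_tsum]
  rw [one_mul]
  have := ENNReal.toReal_mono (ENNReal.mul_ne_top (by simp) (by simp)) h
  rwa [ENNReal.toReal_mul, toReal_enorm, toReal_enorm, toReal_enorm] at this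

/-- The symplectic form as a continuous bilinear map. -/
def symp (hρ : 0 ≤ ρ) : PhaseSpace ρ →L[ℂ] PhaseSpace ρ →L[ℂ] ℂ :=
  LinearMap.mkContinuous₂ (LinearMap.mk₂ ℂ sympForm
    (fun u v w => by
      rw [sympForm, sympForm, sympForm, ← mul_add,
        ← (summable_symp hρ u w).tsum_add (summable_symp hρ v w)]
      congr 1
      refine tsum_congr fun j => ?_
      rw [xi_add, eta_add]
      ring)
    (fun c u v => by
      rw [sympForm, sympForm, smul_eq_mul, mul_left_comm, ← tsum_mul_left (a := c)]
      congr 1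
      refine tsum_congr fun j => ?_
      rw [xi_smul, eta_smul]
      ring)
    (fun u v w => by
      rw [sympForm, sympForm, sympForm, ← mul_add,
        ← (summable_symp hρ u v).tsum_add (summable_symp hρ u w)]
      congr 1
      refine tsum_congr fun j => ?_
      rw [xi_add, eta_add]
      ring)
    (fun c u v => by
      rw [sympForm, sympForm, smul_eq_mul, mul_left_comm, ← tsum_mul_left (a := c)]
      congr 1
      refine tsum_congr fun j => ?_
      rw [xi_smul, eta_smul]
      ring))
    1 (norm_sympForm_le hρ)

theorem symp_apply (hρ : 0 ≤ ρ) (u v : PhaseSpace ρ) : symp hρ u v = sympForm u v := rfl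

theorem symp_swap (hρ : 0 ≤ ρ) (u v : PhaseSpace ρ) : symp hρ u v = -symp hρ v u := by
  rw [symp_apply, symp_apply, sympForm, sympForm, ← mul_neg, ← tsum_neg]
  exact congrArg _ (tsum_congr fun j => by ring)

/-- The vector dual to a coordinate with respect to the symplectic form, that is, the Hamiltonian
vector field of the coordinate. -/
def dualVec (ρ : ℝ) (s : Slot) (j : ℤ) : PhaseSpace ρ :=
  s.elim (fun _ => Complex.I • etaVec ρ j) (fun _ => -Complex.I • xiVec ρ j)

theorem xi_xiVec (j k : ℤ) : (xiVec ρ j).xi k = if k = j then 1 else 0 :=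
  Pi.single_apply j (1 : ℂ) k
theorem eta_xiVec (j k : ℤ) : (xiVec ρ j).eta k = 0 := by
  show (Pi.single j (0 : ℂ) : ℤ → ℂ) k = 0
  simp
theorem xi_etaVec (j k : ℤ) : (etaVec ρ j).xi k = 0 := by
  show (Pi.single j (0 : ℂ) : ℤ → ℂ) k = 0
  simp
theorem eta_etaVec (j k : ℤ) : (etaVec ρ j).eta k = if k = j then 1 else 0 :=
  Pi.single_apply j (1 : ℂ) k

theorem enorm_dualVec (s : Slot) (j : ℤ) : ‖dualVec ρ s j‖ₑ = weight ρ j := by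
  have hI : ‖Complex.I‖ₑ = 1 := by simp [enorm_eq_nnnorm]
  rw [enorm_eq_tsum, tsum_eq_single j]
  · rcases s with s | s <;>
      simp [-neg_smul, dualVec, xi_smul, eta_smul, xi_xiVec, eta_xiVec, xi_etaVec, eta_etaVec, hI]
  · intro k hk
    rcases s with s | s <;>
      simp [-neg_smul, dualVec, xi_smul, eta_smul, xi_xiVec, eta_xiVec, xi_etaVec, eta_etaVec, hk]

theorem symp_etaVec_right (hρ : 0 ≤ ρ) (v : PhaseSpace ρ) (j : ℤ) :
    symp hρ v (etaVec ρ j) = -Complex.I * v.xi j := by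
  rw [symp_apply, sympForm, tsum_eq_single j]
  · simp [xi_etaVec, eta_etaVec]
  · intro k hk
    simp [xi_etaVec, eta_etaVec, hk]

theorem symp_xiVec_right (hρ : 0 ≤ ρ) (v : PhaseSpace ρ) (j : ℤ) :
    symp hρ v (xiVec ρ j) = Complex.I * v.eta j := by
  rw [symp_apply, sympForm, tsum_eq_single j]
  · simp [xi_xiVec, eta_xiVec]
  · intro k hk
    simp [xi_xiVec, eta_xiVec, hk]

theorem symp_dualVec (hρ : 0 ≤ ρ) (s : Slot) (j : ℤ) (v : PhaseSpace ρ) :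
    symp hρ v (dualVec ρ s j) = coord ρ s j v := by
  rcases s with s | s
  · simp only [dualVec, Sum.elim_inl, map_smul, symp_etaVec_right, coord_inl, smul_eq_mul]
    linear_combination (-(v.xi j)) * Complex.I_mul_I
  · simp only [dualVec, Sum.elim_inr, map_smul, symp_xiVec_right, coord_inr, smul_eq_mul]
    linear_combination (-(v.eta j)) * Complex.I_mul_I

/-- A vector field that represents the derivative of `F` through the symplectic form is its
Hamiltonian vector field. -/
theorem isHamiltonianVectorField_of_symp (hρ : 0 ≤ ρ) {F : PhaseSpace ρ → ℂ}
    {X : PhaseSpace ρ → PhaseSpace ρ} {U : Set (PhaseSpace ρ)}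
    (h : ∀ z ∈ U, HasFDerivAt F ((symp hρ).flip (X z)) z) : IsHamiltonianVectorField F X U := by
  intro z hz j
  rw [(h z hz).fderiv, ContinuousLinearMap.flip_apply, ContinuousLinearMap.flip_apply,
    symp_swap, symp_swap hρ (xiVec ρ j), symp_etaVec_right, symp_xiVec_right]
  constructor
  · linear_combination (((X z).xi j)) * Complex.I_mul_I
  · linear_combination (((X z).eta j)) * Complex.I_mul_I

/-! ### Sums over the indices of zero momentum -/

/-- The integer in a given slot of a sextic index. -/
def slotIndex (p : SexticIndex) (s : Slot) : ℤ := Sum.elim p.1 p.2 s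

/-- The sign of a slot: `1` for the variables `ξ` and `-1` for the variables `η`. -/
def slotSign (s : Slot) : ℤ := Sum.elim (fun _ => 1) (fun _ => -1) s

theorem abs_slotSign (s : Slot) : |slotSign s| = 1 := by
  rcases s with s | s <;> simp [slotSign]

theorem slotSign_mul_self (s : Slot) : slotSign s * slotSign s = 1 := by
  rcases s with s | s <;> simp [slotSign]

theorem momentum_eq_sum (p : SexticIndex) :
    momentum p = ∑ s, slotSign s * slotIndex p s := by
  simp [momentum, slotSign, slotIndex, Fintype.sum_sum_type, sub_eq_add_neg]

theorem divisor_eq_sum (p : SexticIndex) :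
    divisor p = ∑ s, slotSign s * slotIndex p s ^ 2 := by
  simp [divisor, slotSign, slotIndex, Fintype.sum_sum_type, sub_eq_add_neg]

theorem monomial_eq_prod (p : SexticIndex) (z : PhaseSpace ρ) :
    monomial p z = ∏ s, coord ρ s (slotIndex p s) z := by
  simp [monomial, slotIndex, Fintype.prod_sum_type]

theorem slotIndex_eq_of_zeroMomentum (p : zeroMomentum) (s : Slot) :
    slotIndex p.1 s = -slotSign s * ∑ t ∈ univ.erase s, slotSign t * slotIndex p.1 t := by
  have h : momentum p.1 = 0 := p.2
  rw [momentum_eq_sum, ← add_sum_erase _ _ (mem_univ s)] at h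
  have h2 := slotSign_mul_self s
  linear_combination (-slotIndex p.1 s) * h2 + slotSign s * h

theorem abs_slotIndex_le (p : zeroMomentum) (s : Slot) :
    |slotIndex p.1 s| ≤ ∑ t ∈ univ.erase s, |slotIndex p.1 t| := by
  rw [slotIndex_eq_of_zeroMomentum p s, abs_mul, abs_neg, abs_slotSign, one_mul]
  refine (abs_sum_le_sum_abs _ _).trans (sum_le_sum fun t _ => ?_)
  rw [abs_mul, abs_slotSign, one_mul]

theorem weight_slotIndex_le (hρ : 0 ≤ ρ) (p : zeroMomentum) (s : Slot) :
    weight ρ (slotIndex p.1 s) ≤ ∏ t ∈ univ.erase s, weight ρ (slotIndex p.1 t) := by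
  simp only [weight]
  rw [← ENNReal.ofReal_prod_of_nonneg fun _ _ => (Real.exp_pos _).le, ← Real.exp_sum, ← mul_sum]
  refine ENNReal.ofReal_le_ofReal (Real.exp_le_exp.2 (mul_le_mul_of_nonneg_left ?_ hρ))
  exact_mod_cast abs_slotIndex_le p s

theorem tsum_pi_prod_le {κ : Type*} [Fintype κ] (a : κ → ℤ → ℝ≥0∞) :
    ∑' q : κ → ℤ, ∏ t, a t (q t) ≤ ∏ t, ∑' j, a t j := by
  classical
  rw [ENNReal.tsum_eq_iSup_sum]
  refine iSup_le fun S => ?_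
  calc ∑ q ∈ S, ∏ t, a t (q t)
      ≤ ∑ q ∈ Fintype.piFinset fun t => S.image fun q => q t, ∏ t, a t (q t) :=
        sum_le_sum_of_subset fun q hq => Fintype.mem_piFinset.2 fun t =>
          mem_image_of_mem (fun q : κ → ℤ => q t) hq
    _ = ∏ t, ∑ j ∈ S.image fun q => q t, a t j := (prod_univ_sum _ _).symm
    _ ≤ _ := prod_le_prod' fun t _ => ENNReal.sum_le_tsum _

/-- The convolution estimate behind all the bounds below: the integer in one slot of an index of
zero momentum is determined by the five others, so a product over these five slots is summable
over all indices of zero momentum. -/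
theorem tsum_prod_erase_le (s : Slot) (a : Slot → ℤ → ℝ≥0∞) :
    ∑' p : zeroMomentum, ∏ t ∈ univ.erase s, a t (slotIndex p.1 t) ≤
      ∏ t ∈ univ.erase s, ∑' j, a t j := by
  set φ : zeroMomentum → (↥(univ.erase s) → ℤ) := fun p t => slotIndex p.1 t with hφ
  have hinj : Function.Injective φ := by
    intro p q hpq
    have h1 : ∀ t ∈ univ.erase s, slotIndex p.1 t = slotIndex q.1 t := fun t ht =>
      congrFun hpq ⟨t, ht⟩
    have h2 : ∀ t, slotIndex p.1 t = slotIndex q.1 t := by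
      intro t
      by_cases hts : t = s
      · subst hts
        rw [slotIndex_eq_of_zeroMomentum, slotIndex_eq_of_zeroMomentum q]
        congr 1
        exact sum_congr rfl fun r hr => by rw [h1 r hr]
      · exact h1 t (by simp [hts])
    exact Subtype.ext (Prod.ext (funext fun i => h2 (Sum.inl i)) (funext fun i => h2 (Sum.inr i)))
  have h := ENNReal.tsum_comp_le_tsum_of_injective hinj
    fun q => ∏ t : ↥(univ.erase s), a t (q t)
  refine (le_of_eq (tsum_congr fun p => ?_)).trans
    (h.trans ((tsum_pi_prod_le _).trans (le_of_eq ?_)))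
  · exact (prod_coe_sort _ fun t => a t (slotIndex p.1 t)).symm
  · exact prod_coe_sort _ fun t => ∑' j, a t j

/-! ### Sextic Hamiltonians and their vector fields -/

/-- A series of multilinear maps whose values are summable with a uniform bound has a continuous
multilinear sum, although the maps themselves need not be summable in norm. -/
theorem exists_multilinear_hasSum {Z κ E E' : Type*} [Fintype κ] [NormedAddCommGroup E]
    [NormedSpace ℂ E] [NormedAddCommGroup E'] [NormedSpace ℂ E'] [CompleteSpace E']
    (M : Z → ContinuousMultilinearMap ℂ (fun _ : κ => E) E')
    (h : ∀ v, ∑' p, ‖M p v‖ₑ ≤ ∏ t, ‖v t‖ₑ) :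
    ∃ L : ContinuousMultilinearMap ℂ (fun _ : κ => E) E', ∀ v, HasSum (fun p => M p v) (L v) := by
  have htop : ∀ v : κ → E, ∏ t, ‖v t‖ₑ ≠ ⊤ := fun v => ENNReal.prod_ne_top fun t _ => by simp
  have hs : ∀ v, Summable fun p => M p v := fun v =>
    Summable.of_enorm (ne_top_of_le_ne_top (htop v) (h v))
  let L₀ : MultilinearMap ℂ (fun _ : κ => E) E' :=
    { toFun := fun v => ∑' p, M p v
      map_update_add' := fun v i x y => by
        rw [← (hs _).tsum_add (hs _)]
        exact tsum_congr fun p => (M p).map_update_add v i x y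
      map_update_smul' := fun v i c x => by
        rw [← (hs _).tsum_const_smul c]
        exact tsum_congr fun p => (M p).map_update_smul v i c x }
  refine ⟨L₀.mkContinuous 1 fun v => ?_, fun v => (hs v).hasSum⟩
  have h1 : ‖L₀ v‖ₑ ≤ ∏ t, ‖v t‖ₑ := enorm_tsum_le_tsum_enorm.trans (h v)
  have h2 := ENNReal.toReal_mono (htop v) h1
  rw [ENNReal.toReal_prod] at h2
  simpa using h2

/-- The sextic Hamiltonian of zero momentum with coefficients `c`. -/
def sextic (c : zeroMomentum → ℂ) (z : PhaseSpace ρ) : ℂ :=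
  ∑' p : zeroMomentum, c p * monomial p.1 z

/-- The contribution of the derivatives in the slot `s` to the Hamiltonian vector field of
`sextic c`. -/
def slotField (c : zeroMomentum → ℂ) (s : Slot) (z : PhaseSpace ρ) : PhaseSpace ρ :=
  ∑' p : zeroMomentum, (c p * ∏ t ∈ univ.erase s, coord ρ t (slotIndex p.1 t) z) •
    dualVec ρ s (slotIndex p.1 s)

/-- The Hamiltonian vector field of `sextic c`. -/
def sexticField (c : zeroMomentum → ℂ) (z : PhaseSpace ρ) : PhaseSpace ρ :=
  ∑ s, slotField c s z

variable {c : zeroMomentum → ℂ}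

theorem exists_multilinear_sextic (hρ : 0 ≤ ρ) (hc : ∀ p, ‖c p‖ₑ ≤ 1) :
    ∃ L : ContinuousMultilinearMap ℂ (fun _ : Slot => PhaseSpace ρ) ℂ,
      ∀ v, HasSum (fun p : zeroMomentum => c p * ∏ s, coord ρ s (slotIndex p.1 s) (v s)) (L v) := by
  refine exists_multilinear_hasSum (fun p : zeroMomentum => c p •
    (ContinuousMultilinearMap.mkPiAlgebra ℂ Slot ℂ).compContinuousLinearMap
      fun s => coord ρ s (slotIndex p.1 s)) fun v => ?_
  rw [← mul_prod_erase _ _ (mem_univ (Sum.inl 0 : Slot))]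
  calc _ ≤ ∑' p : zeroMomentum, ‖v (Sum.inl 0)‖ₑ *
        ∏ t ∈ univ.erase (Sum.inl 0), ‖coord ρ t (slotIndex p.1 t) (v t)‖ₑ := by
        refine ENNReal.tsum_le_tsum fun p => ?_
        show ‖c p • ∏ s, coord ρ s (slotIndex p.1 s) (v s)‖ₑ ≤ _
        rw [enorm_smul, ← mul_prod_erase _ _ (mem_univ (Sum.inl 0 : Slot)), enorm_mul]
        have h1 : ‖∏ t ∈ univ.erase (Sum.inl 0), coord ρ t (slotIndex p.1 t) (v t)‖ₑ =
            ∏ t ∈ univ.erase (Sum.inl 0), ‖coord ρ t (slotIndex p.1 t) (v t)‖ₑ := by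
          simp only [enorm_eq_nnnorm, nnnorm_prod, ENNReal.ofNNReal_finsetProd]
        rw [h1]
        refine (mul_le_of_le_one_left' (hc p)).trans ?_
        gcongr
        exact coord_le hρ _ _ _
    _ ≤ _ := by
        rw [ENNReal.tsum_mul_left]
        gcongr
        refine (tsum_prod_erase_le _ fun t j => ‖coord ρ t j (v t)‖ₑ).trans ?_
        exact prod_le_prod' fun t _ => tsum_coord_le hρ t (v t)

theorem exists_multilinear_slotField (hρ : 0 ≤ ρ) (hc : ∀ p, ‖c p‖ₑ ≤ 1) (s : Slot) :
    ∃ L : ContinuousMultilinearMap ℂ (fun _ : ↥(univ.erase s) => PhaseSpace ρ)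
      (PhaseSpace ρ), ∀ z : PhaseSpace ρ, HasSum (fun p : zeroMomentum =>
        (c p * ∏ t ∈ univ.erase s, coord ρ t (slotIndex p.1 t) z) •
          dualVec ρ s (slotIndex p.1 s)) (L fun _ => z) := by
  obtain ⟨L, hL⟩ := exists_multilinear_hasSum (fun p : zeroMomentum => c p •
    ((ContinuousMultilinearMap.mkPiAlgebra ℂ ↥(univ.erase s) ℂ).compContinuousLinearMap
      fun t => coord ρ t (slotIndex p.1 t)).smulRight (dualVec ρ s (slotIndex p.1 s))) fun v => by
    set w : Slot → PhaseSpace ρ := fun t => if h : t ∈ univ.erase s then v ⟨t, h⟩ else 0 with hw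
    have hwv : ∀ t : ↥(univ.erase s), w t = v t := fun t => dif_pos t.2
    have h0 : ∏ t, ‖v t‖ₑ = ∏ t ∈ univ.erase s, ‖w t‖ₑ := by
      rw [← prod_coe_sort _ fun t => ‖w t‖ₑ]
      exact prod_congr rfl fun t _ => by rw [hwv]
    rw [h0]
    calc _ ≤ ∑' p : zeroMomentum, ∏ t ∈ univ.erase s,
          (weight ρ (slotIndex p.1 t) * ‖coord ρ t (slotIndex p.1 t) (w t)‖ₑ) := by
          refine ENNReal.tsum_le_tsum fun p => ?_
          show ‖c p • ((∏ t : ↥(univ.erase s), coord ρ t (slotIndex p.1 t) (v t)) •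
            dualVec ρ s (slotIndex p.1 s))‖ₑ ≤ _
          rw [enorm_smul, enorm_smul, enorm_dualVec, prod_mul_distrib]
          have h1 : ‖∏ t : ↥(univ.erase s), coord ρ t (slotIndex p.1 t) (v t)‖ₑ =
              ∏ t ∈ univ.erase s, ‖coord ρ t (slotIndex p.1 t) (w t)‖ₑ := by
            rw [← prod_coe_sort _ fun t => ‖coord ρ t (slotIndex p.1 t) (w t)‖ₑ]
            simp only [enorm_eq_nnnorm, nnnorm_prod, ENNReal.ofNNReal_finsetProd, hwv]
          rw [h1, mul_comm (∏ t ∈ _, weight _ _)]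
          refine (mul_le_of_le_one_left' (hc p)).trans ?_
          gcongr
          exact weight_slotIndex_le hρ p s
      _ ≤ _ := by
          refine (tsum_prod_erase_le s fun t j => weight ρ j * ‖coord ρ t j (w t)‖ₑ).trans ?_
          exact prod_le_prod' fun t _ => tsum_weight_mul_coord_le t (w t)
  refine ⟨L, fun z => (hL fun _ => z).congr_fun fun p => ?_⟩
  show _ = c p • ((∏ t : ↥(univ.erase s), coord ρ t (slotIndex p.1 t) z) •
            dualVec ρ s (slotIndex p.1 s))
  rw [smul_smul, prod_coe_sort _ fun t => coord ρ t (slotIndex p.1 t) z]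

theorem hasSum_slotField (hρ : 0 ≤ ρ) (hc : ∀ p, ‖c p‖ₑ ≤ 1) (s : Slot) (z : PhaseSpace ρ) :
    HasSum (fun p : zeroMomentum => (c p * ∏ t ∈ univ.erase s, coord ρ t (slotIndex p.1 t) z) •
      dualVec ρ s (slotIndex p.1 s)) (slotField c s z) :=
  (exists_multilinear_slotField hρ hc s).elim fun _ h => (h z).summable.hasSum

theorem summable_sextic (hρ : 0 ≤ ρ) (hc : ∀ p, ‖c p‖ₑ ≤ 1) (z : PhaseSpace ρ) :
    Summable fun p : zeroMomentum => c p * monomial p.1 z := by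
  obtain ⟨L, hL⟩ := exists_multilinear_sextic hρ hc
  simpa only [monomial_eq_prod] using (hL fun _ => z).summable

theorem contDiff_slotField (hρ : 0 ≤ ρ) (hc : ∀ p, ‖c p‖ₑ ≤ 1) (s : Slot) :
    ContDiff ℂ ∞ (slotField (ρ := ρ) c s) := by
  obtain ⟨L, hL⟩ := exists_multilinear_slotField hρ hc s
  have h : slotField (ρ := ρ) c s = fun z => L fun _ => z := funext fun z => (hL z).tsum_eq
  rw [h]
  exact L.contDiff.comp (contDiff_pi.2 fun _ => contDiff_id)

theorem contDiff_sexticField (hρ : 0 ≤ ρ) (hc : ∀ p, ‖c p‖ₑ ≤ 1) :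
    ContDiff ℂ ∞ (sexticField (ρ := ρ) c) :=
  ContDiff.sum fun s _ => contDiff_slotField hρ hc s

theorem exists_lipschitz_slotField (hρ : 0 ≤ ρ) (hc : ∀ p, ‖c p‖ₑ ≤ 1) (s : Slot) :
    ∃ K : ℝ, 0 ≤ K ∧ ∀ z w : PhaseSpace ρ,
      ‖slotField c s z - slotField c s w‖ ≤ K * max ‖z‖ ‖w‖ ^ 4 * ‖z - w‖ := by
  obtain ⟨L, hL⟩ := exists_multilinear_slotField hρ hc s
  refine ⟨‖L‖ * 5, by positivity, fun z w => ?_⟩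
  have hcard : Fintype.card ↥(univ.erase s) = 5 := by simp
  have : Nonempty ↥(univ.erase s) := Fintype.card_pos_iff.1 (by rw [hcard]; norm_num)
  have h := L.norm_image_sub_le (fun _ => z) (fun _ => w)
  have hsub : ((fun _ => z) - fun _ => w : ↥(univ.erase s) → PhaseSpace ρ) =
      fun _ => z - w := rfl
  rw [hcard, hsub, pi_norm_const, pi_norm_const, pi_norm_const] at h
  rw [slotField, slotField, (hL z).tsum_eq, (hL w).tsum_eq]
  exact_mod_cast h

/-- The vector field of a sextic Hamiltonian is of degree five, with a uniform Lipschitz bound. -/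
theorem exists_lipschitz_sexticField (hρ : 0 ≤ ρ) (hc : ∀ p, ‖c p‖ₑ ≤ 1) :
    ∃ K : ℝ, 0 ≤ K ∧ ∀ z w : PhaseSpace ρ,
      ‖sexticField c z - sexticField c w‖ ≤ K * max ‖z‖ ‖w‖ ^ 4 * ‖z - w‖ := by
  choose K hK0 hK using exists_lipschitz_slotField (c := c) hρ hc
  refine ⟨∑ s, K s, sum_nonneg fun s _ => hK0 s, fun z w => ?_⟩
  rw [sexticField, sexticField, ← sum_sub_distrib, sum_mul, sum_mul]
  exact norm_sum_le_of_le _ fun s _ => hK s z w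

theorem slotField_zero (s : Slot) : slotField c s (0 : PhaseSpace ρ) = 0 := by
  have hne : (univ.erase s).Nonempty := card_pos.1 (by simp)
  obtain ⟨t, ht⟩ := hne
  have h : ∀ p : zeroMomentum,
      ∏ t ∈ univ.erase s, coord ρ t (slotIndex p.1 t) (0 : PhaseSpace ρ) = 0 := fun p =>
    prod_eq_zero ht (map_zero _)
  simp only [slotField, h, mul_zero, zero_smul, tsum_zero]

theorem sexticField_zero : sexticField c (0 : PhaseSpace ρ) = 0 := by
  simp [sexticField, slotField_zero]

/-- The slot field represents the partial derivatives of the Hamiltonian in the given slot. -/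
theorem hasSum_symp_slotField (hρ : 0 ≤ ρ) (hc : ∀ p, ‖c p‖ₑ ≤ 1) (s : Slot)
    (v z : PhaseSpace ρ) :
    HasSum (fun p : zeroMomentum => (c p * ∏ t ∈ univ.erase s, coord ρ t (slotIndex p.1 t) z) *
      coord ρ s (slotIndex p.1 s) v) (symp hρ v (slotField c s z)) := by
  refine ((hasSum_slotField hρ hc s z).mapL (symp hρ v)).congr_fun fun p => ?_
  rw [map_smul, symp_dualVec, smul_eq_mul]

theorem hasFDerivAt_sextic (hρ : 0 ≤ ρ) (hc : ∀ p, ‖c p‖ₑ ≤ 1) (z : PhaseSpace ρ) :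
    HasFDerivAt (sextic c) ((symp hρ).flip (sexticField c z)) z := by
  obtain ⟨L, hL⟩ := exists_multilinear_sextic hρ hc
  have hF : sextic (ρ := ρ) c = fun z => L fun _ => z := funext fun z => by
    simp only [sextic, monomial_eq_prod]
    exact (hL _).tsum_eq
  rw [hF]
  have hd : HasFDerivAt (fun z : PhaseSpace ρ => (fun _ : Slot => z))
      (ContinuousLinearMap.pi fun _ => ContinuousLinearMap.id ℂ (PhaseSpace ρ)) z :=
    hasFDerivAt_pi.2 fun _ => hasFDerivAt_id z
  have h := (L.hasFDerivAt fun _ : Slot => z).comp z hd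
  refine h.congr_fderiv (ContinuousLinearMap.ext fun v => ?_)
  show L.linearDeriv (fun _ => z) (fun _ => v) = symp hρ v (sexticField c z)
  rw [ContinuousMultilinearMap.linearDeriv_apply, sexticField, map_sum]
  refine sum_congr rfl fun s _ => ?_
  refine (hL _).unique ((hasSum_symp_slotField hρ hc s v z).congr_fun fun p => ?_)
  rw [← mul_prod_erase _ _ (mem_univ s), Function.update_self, mul_comm (coord ρ s _ v),
    ← mul_assoc]
  congr 2
  refine prod_congr rfl fun t ht => ?_
  rw [Function.update_of_ne (ne_of_mem_erase ht)]

theorem contDiff_sextic (hρ : 0 ≤ ρ) (hc : ∀ p, ‖c p‖ₑ ≤ 1) :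
    ContDiff ℂ ∞ (sextic (ρ := ρ) c) := by
  obtain ⟨L, hL⟩ := exists_multilinear_sextic (ρ := ρ) hρ hc
  have hF : sextic (ρ := ρ) c = fun z => L fun _ => z := funext fun z => by
    simp only [sextic, monomial_eq_prod]
    exact (hL _).tsum_eq
  rw [hF]
  exact L.contDiff.comp (contDiff_pi.2 fun _ => contDiff_id)

/-- The derivative of a Hamiltonian vector field is skew for the symplectic form: this is the
symmetry of the second derivative of the Hamiltonian. -/
theorem symp_fderiv_sexticField (hρ : 0 ≤ ρ) (hc : ∀ p, ‖c p‖ₑ ≤ 1) (z u v : PhaseSpace ρ) :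
    symp hρ (fderiv ℂ (sexticField c) z u) v = -symp hρ u (fderiv ℂ (sexticField c) z v) := by
  have hX : HasFDerivAt (sexticField c) (fderiv ℂ (sexticField c) z) z :=
    ((contDiff_sexticField hρ hc).differentiable (by simp) z).hasFDerivAt
  have h := second_derivative_symmetric (hasFDerivAt_sextic (c := c) hρ hc)
    ((symp hρ).flip.hasFDerivAt.comp z hX) u v
  rw [symp_swap]
  exact congrArg _ h

/-! ### The energy -/

/-- `∑ j, j² (|ξ j|² + |η j|²)` as an extended nonnegative real. -/
def energy (z : PhaseSpace ρ) : ℝ≥0∞ :=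
  ∑' j : ℤ, ‖(j : ℝ)‖ₑ ^ 2 * (‖z.xi j‖ₑ ^ 2 + ‖z.eta j‖ₑ ^ 2)

theorem finiteEnergy_iff (z : PhaseSpace ρ) : FiniteEnergy z ↔ energy z ≠ ⊤ := by
  have h : energy z =
      ∑' j : ℤ, ‖(j : ℝ) ^ 2 * (‖z.xi j‖ ^ 2 + ‖z.eta j‖ ^ 2)‖ₑ := by
    refine tsum_congr fun j => ?_
    rw [enorm_mul, enorm_pow,
      Real.enorm_eq_ofReal (r := ‖z.xi j‖ ^ 2 + ‖z.eta j‖ ^ 2) (by positivity),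
      ENNReal.ofReal_add (by positivity) (by positivity), ENNReal.ofReal_pow (norm_nonneg _),
      ENNReal.ofReal_pow (norm_nonneg _), ofReal_norm, ofReal_norm]
  rw [h, tsum_enorm_ne_top_iff_summable_norm, FiniteEnergy, summable_norm_iff]

theorem enorm_mul_coord_sq_le_energy (s : Slot) (z : PhaseSpace ρ) :
    ∑' j : ℤ, (‖(j : ℝ)‖ₑ * ‖coord ρ s j z‖ₑ) ^ 2 ≤ energy z := by
  refine ENNReal.tsum_le_tsum fun j => ?_
  rw [mul_pow]
  gcongr
  rcases s with s | s
  · exact le_self_add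
  · exact le_add_self

theorem energy_eq_add (z : PhaseSpace ρ) :
    energy z = ∑' j : ℤ, (‖(j : ℝ)‖ₑ * ‖coord ρ (Sum.inl 0) j z‖ₑ) ^ 2 +
      ∑' j : ℤ, (‖(j : ℝ)‖ₑ * ‖coord ρ (Sum.inr 0) j z‖ₑ) ^ 2 := by
  rw [← ENNReal.tsum_add]
  exact tsum_congr fun j => by rw [coord_inl, coord_inr, mul_pow, mul_pow, mul_add]

theorem ennreal_two_mul_le_add_sq (a b : ℝ≥0∞) : 2 * (a * b) ≤ a ^ 2 + b ^ 2 := by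
  rcases le_total a b with h | h
  · obtain ⟨d, rfl⟩ := exists_add_of_le h
    calc 2 * (a * (a + d)) ≤ 2 * (a * (a + d)) + d ^ 2 := le_self_add
      _ = _ := by ring
  · obtain ⟨d, rfl⟩ := exists_add_of_le h
    calc 2 * ((b + d) * b) ≤ 2 * ((b + d) * b) + d ^ 2 := le_self_add
      _ = _ := by ring

theorem ennreal_add_sq_le (a b : ℝ≥0∞) : (a + b) ^ 2 ≤ 2 * (a ^ 2 + b ^ 2) := by
  calc (a + b) ^ 2 = a ^ 2 + b ^ 2 + 2 * (a * b) := by ring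
    _ ≤ a ^ 2 + b ^ 2 + (a ^ 2 + b ^ 2) := by gcongr; exact ennreal_two_mul_le_add_sq a b
    _ = _ := by ring

/-- The Cauchy-Schwarz inequality for series of extended nonnegative reals. -/
theorem ennreal_sq_tsum_mul_le {ι : Type*} (α β : ι → ℝ≥0∞) :
    (∑' x, α x * β x) ^ 2 ≤ (∑' x, α x) * ∑' x, α x * β x ^ 2 := by
  have h : 2 * (∑' x, α x * β x) ^ 2 ≤ 2 * ((∑' x, α x) * ∑' x, α x * β x ^ 2) := by
    calc 2 * (∑' x, α x * β x) ^ 2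
        = ∑' x, ∑' y, α x * α y * (2 * (β x * β y)) := by
          rw [sq, ← ENNReal.tsum_mul_right, ← ENNReal.tsum_mul_left]
          refine tsum_congr fun x => ?_
          rw [← ENNReal.tsum_mul_left, ← ENNReal.tsum_mul_left]
          exact tsum_congr fun y => by ring
      _ ≤ ∑' x, ∑' y, α x * α y * (β x ^ 2 + β y ^ 2) := by
          gcongr
          exact ennreal_two_mul_le_add_sq _ _
      _ = ∑' x, ∑' y, (α x * β x ^ 2 * α y) + ∑' x, ∑' y, (α x * (α y * β y ^ 2)) := by
          rw [← ENNReal.tsum_add]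
          refine tsum_congr fun x => ?_
          rw [← ENNReal.tsum_add]
          exact tsum_congr fun y => by ring
      _ = _ := by
          simp only [ENNReal.tsum_mul_left, ENNReal.tsum_mul_right]
          ring
  exact (ENNReal.mul_le_mul_iff_right (by simp) (by simp)).1 h

theorem energy_add_le (z w : PhaseSpace ρ) : energy (z + w) ≤ 2 * (energy z + energy w) := by
  rw [energy, energy, energy, ← ENNReal.tsum_add, ← ENNReal.tsum_mul_left]
  refine ENNReal.tsum_le_tsum fun j => ?_
  calc ‖(j : ℝ)‖ₑ ^ 2 * (‖(z + w).xi j‖ₑ ^ 2 + ‖(z + w).eta j‖ₑ ^ 2)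
      ≤ ‖(j : ℝ)‖ₑ ^ 2 * (2 * (‖z.xi j‖ₑ ^ 2 + ‖w.xi j‖ₑ ^ 2) +
          2 * (‖z.eta j‖ₑ ^ 2 + ‖w.eta j‖ₑ ^ 2)) := by
        rw [xi_add, eta_add]
        gcongr
        · exact (pow_le_pow_left' (enorm_add_le _ _) 2).trans (ennreal_add_sq_le _ _)
        · exact (pow_le_pow_left' (enorm_add_le _ _) 2).trans (ennreal_add_sq_le _ _)
    _ = _ := by ring

theorem energy_smul (a : ℂ) (z : PhaseSpace ρ) : energy (a • z) = ‖a‖ₑ ^ 2 * energy z := by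
  rw [energy, energy, ← ENNReal.tsum_mul_left]
  refine tsum_congr fun j => ?_
  rw [xi_smul, eta_smul, enorm_mul, enorm_mul]
  ring

theorem isClosed_energy_le (M : ℝ≥0∞) : IsClosed {z : PhaseSpace ρ | energy z ≤ M} := by
  have h : LowerSemicontinuous (energy (ρ := ρ)) := by
    refine lowerSemicontinuous_tsum fun j => Continuous.lowerSemicontinuous ?_
    refine (ENNReal.continuous_const_mul (by simp)).comp (Continuous.fun_add ?_ ?_)
    · exact (ENNReal.continuous_pow 2).comp (coord ρ (Sum.inl 0) j).continuous.enorm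
    · exact (ENNReal.continuous_pow 2).comp (coord ρ (Sum.inr 0) j).continuous.enorm
  exact h.isClosed_preimage M

/-! ### Hamiltonian vector fields of zero momentum preserve finite energy -/

theorem enorm_slotIndex_le (p : zeroMomentum) (s : Slot) :
    ‖(slotIndex p.1 s : ℝ)‖ₑ ≤ ∑ t ∈ univ.erase s, ‖(slotIndex p.1 t : ℝ)‖ₑ := by
  simp only [← ofReal_norm, Real.norm_eq_abs]
  rw [← ENNReal.ofReal_sum_of_nonneg fun _ _ => abs_nonneg _]
  refine ENNReal.ofReal_le_ofReal ?_
  exact_mod_cast abs_slotIndex_le p s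

theorem tsum_mul_prod_erase_erase_le (hρ : 0 ≤ ρ) {s t : Slot} (hst : t ≠ s) (g : ℤ → ℝ≥0∞)
    (z : PhaseSpace ρ) :
    ∑' p : zeroMomentum, g (slotIndex p.1 t) *
      ∏ r ∈ (univ.erase s).erase t, ‖coord ρ r (slotIndex p.1 r) z‖ₑ ≤ (∑' j, g j) * ‖z‖ₑ ^ 4 := by
  set b : Slot → ℤ → ℝ≥0∞ := Function.update (fun r j => ‖coord ρ r j z‖ₑ) t g with hb
  have hbt : b t = g := Function.update_self _ _ _
  have hbr : ∀ r ∈ (univ.erase s).erase t, b r = fun j => ‖coord ρ r j z‖ₑ := fun r hr =>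
    Function.update_of_ne (ne_of_mem_erase hr) _ _
  have ht : t ∈ univ.erase s := mem_erase.2 ⟨hst, mem_univ t⟩
  have hcard : #((univ.erase s).erase t) = 4 := by rw [card_erase_of_mem ht]; simp
  have h := tsum_prod_erase_le s b
  rw [← mul_prod_erase _ _ ht, hbt] at h
  refine (le_of_eq (tsum_congr fun p => ?_)).trans (h.trans ?_)
  · rw [← mul_prod_erase _ _ ht, hbt]
    exact congrArg _ (prod_congr rfl fun r hr => by rw [hbr r hr])
  · gcongr
    calc _ ≤ ∏ r ∈ (univ.erase s).erase t, ‖z‖ₑ := prod_le_prod' fun r hr => by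
          rw [hbr r hr]
          exact tsum_coord_le hρ r z
      _ = _ := by rw [prod_const, hcard]

theorem enorm_coord_dualVec_le (r s : Slot) (j k : ℤ) :
    ‖coord ρ r j (dualVec ρ s k)‖ₑ ≤ if k = j then 1 else 0 := by
  have hI : ‖Complex.I‖ₑ = 1 := by simp [enorm_eq_nnnorm]
  rcases eq_or_ne k j with rfl | h
  · rcases r with r | r <;> rcases s with s | s <;>
      simp [-neg_smul, dualVec, xi_xiVec, eta_xiVec, xi_etaVec, eta_etaVec, hI]
  · rcases r with r | r <;> rcases s with s | s <;>
      simp [-neg_smul, dualVec, xi_xiVec, eta_xiVec, xi_etaVec, eta_etaVec, h, h.symm]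

variable {c : zeroMomentum → ℂ}

theorem enorm_coord_sexticField_le (hρ : 0 ≤ ρ) (hc : ∀ p, ‖c p‖ₑ ≤ 1) (r : Slot) (j : ℤ)
    (z : PhaseSpace ρ) :
    ‖coord ρ r j (sexticField c z)‖ₑ ≤ ∑ s, ∑' p : zeroMomentum,
      if slotIndex p.1 s = j then
        ∏ t ∈ univ.erase s, ‖coord ρ t (slotIndex p.1 t) z‖ₑ else 0 := by
  rw [sexticField, map_sum]
  refine (enorm_sum_le _ _).trans (sum_le_sum fun s _ => ?_)
  rw [← ((hasSum_slotField hρ hc s z).mapL (coord ρ r j)).tsum_eq]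
  refine enorm_tsum_le_tsum_enorm.trans (ENNReal.tsum_le_tsum fun p => ?_)
  have h1 : ‖∏ t ∈ univ.erase s, coord ρ t (slotIndex p.1 t) z‖ₑ =
      ∏ t ∈ univ.erase s, ‖coord ρ t (slotIndex p.1 t) z‖ₑ := by
    simp only [enorm_eq_nnnorm, nnnorm_prod, ENNReal.ofNNReal_finsetProd]
  rw [map_smul, enorm_smul, enorm_mul, h1]
  have h2 := enorm_coord_dualVec_le (ρ := ρ) r s j (slotIndex p.1 s)
  have h3 : ‖c p‖ₑ * ∏ t ∈ univ.erase s, ‖coord ρ t (slotIndex p.1 t) z‖ₑ ≤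
      ∏ t ∈ univ.erase s, ‖coord ρ t (slotIndex p.1 t) z‖ₑ := mul_le_of_le_one_left' (hc p)
  refine (mul_le_mul' h3 h2).trans ?_
  split_ifs <;> simp

/-- The squares are estimated by the Cauchy-Schwarz inequality: the weight `|j|` of the output slot
`s` is moved to another slot `t` by the conservation of momentum. In the first factor of
Cauchy-Schwarz the slot `t` is then the free one, in the second the slot `s`. -/
theorem tsum_coord_sexticField_sq_le (hρ : 0 ≤ ρ) (hc : ∀ p, ‖c p‖ₑ ≤ 1) (r : Slot)
    (z : PhaseSpace ρ) :
    ∑' j : ℤ, (‖(j : ℝ)‖ₑ * ‖coord ρ r j (sexticField c z)‖ₑ) ^ 2 ≤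
      36 ^ 2 * ‖z‖ₑ ^ 8 * energy z := by
  set α : ℤ → zeroMomentum × Slot × Slot → ℝ≥0∞ := fun j x =>
    if x.2.2 ≠ x.2.1 ∧ slotIndex x.1.1 x.2.1 = j then
      ∏ r ∈ (univ.erase x.2.1).erase x.2.2, ‖coord ρ r (slotIndex x.1.1 r) z‖ₑ else 0 with hα
  set β : zeroMomentum × Slot × Slot → ℝ≥0∞ := fun x =>
    ‖(slotIndex x.1.1 x.2.2 : ℝ)‖ₑ * ‖coord ρ x.2.2 (slotIndex x.1.1 x.2.2) z‖ₑ with hβ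
  have hsum : ∀ f : zeroMomentum × Slot × Slot → ℝ≥0∞,
      ∑' x, f x = ∑ s, ∑ t, ∑' p, f (p, s, t) := fun f => by
    rw [ENNReal.tsum_prod', ENNReal.tsum_comm, tsum_fintype, Fintype.sum_prod_type]
  have h1 : ∀ j : ℤ, ‖(j : ℝ)‖ₑ * ‖coord ρ r j (sexticField c z)‖ₑ ≤ ∑' x, α j x * β x := by
    intro j
    refine (mul_le_mul_right (enorm_coord_sexticField_le hρ hc r j z) _).trans ?_
    rw [hsum, mul_sum]
    refine sum_le_sum fun s _ => ?_
    rw [← tsum_fintype (L := .unconditional _), ENNReal.tsum_comm, ← ENNReal.tsum_mul_left]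
    refine ENNReal.tsum_le_tsum fun p => ?_
    rw [tsum_fintype]
    by_cases hj : slotIndex p.1 s = j
    · rw [if_pos hj, ← hj]
      refine (mul_le_mul_left (enorm_slotIndex_le p s) _).trans ?_
      rw [sum_mul]
      refine (sum_le_sum fun t ht => le_of_eq ?_).trans (sum_le_univ_sum_of_nonneg fun _ => zero_le)
      rw [← mul_prod_erase _ _ ht]
      simp only [hα, hβ]
      rw [if_pos ⟨ne_of_mem_erase ht, trivial⟩]
      ring
    · rw [if_neg hj, mul_zero]
      exact zero_le
  have h2 : ∀ j : ℤ, ∑' x, α j x ≤ 36 * ‖z‖ₑ ^ 4 := by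
    intro j
    rw [hsum]
    have hst : ∀ s t : Slot, ∑' p, α j (p, s, t) ≤ ‖z‖ₑ ^ 4 := fun s t => by
      by_cases hts : t = s
      · simp [hα, hts]
      · have h := tsum_mul_prod_erase_erase_le hρ (s := t) (t := s) (Ne.symm hts)
          (fun k => if k = j then 1 else 0) z
        rw [tsum_ite_eq, one_mul] at h
        refine le_trans (le_of_eq (tsum_congr fun p => ?_)) h
        simp only [hα, erase_right_comm (a := t), ne_eq, hts, not_false_eq_true, true_and]
        split_ifs <;> simp
    refine (sum_le_sum fun s _ => sum_le_sum fun t _ => hst s t).trans (le_of_eq ?_)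
    simp only [sum_const, card_univ, Fintype.card_sum, Fintype.card_fin, nsmul_eq_mul]
    push_cast
    ring
  have h3 : ∑' j : ℤ, ∑' x, α j x * β x ^ 2 ≤ 36 * ‖z‖ₑ ^ 4 * energy z := by
    rw [ENNReal.tsum_comm, hsum]
    have hst : ∀ s t : Slot, ∑' p, ∑' j, α j (p, s, t) * β (p, s, t) ^ 2 ≤
        energy z * ‖z‖ₑ ^ 4 := fun s t => by
      by_cases hts : t = s
      · simp [hα, hts]
      · have h := tsum_mul_prod_erase_erase_le hρ (s := s) (t := t) hts
          (fun k => (‖(k : ℝ)‖ₑ * ‖coord ρ t k z‖ₑ) ^ 2) z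
        refine le_trans (le_of_eq (tsum_congr fun p => ?_)) (h.trans ?_)
        · rw [ENNReal.tsum_mul_right]
          simp only [hα, hβ, ne_eq, hts, not_false_eq_true, true_and]
          rw [mul_comm, tsum_eq_single (slotIndex p.1 s) fun k hk => if_neg (Ne.symm hk),
            if_pos rfl]
        · gcongr
          exact enorm_mul_coord_sq_le_energy t z
    refine (sum_le_sum fun s _ => sum_le_sum fun t _ => hst s t).trans (le_of_eq ?_)
    simp only [sum_const, card_univ, Fintype.card_sum, Fintype.card_fin, nsmul_eq_mul]
    push_cast
    ring
  calc ∑' j : ℤ, (‖(j : ℝ)‖ₑ * ‖coord ρ r j (sexticField c z)‖ₑ) ^ 2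
      ≤ ∑' j : ℤ, (36 * ‖z‖ₑ ^ 4) * ∑' x, α j x * β x ^ 2 :=
        ENNReal.tsum_le_tsum fun j => (pow_le_pow_left' (h1 j) 2).trans
          ((ennreal_sq_tsum_mul_le _ _).trans (mul_le_mul_left (h2 j) _))
    _ ≤ (36 * ‖z‖ₑ ^ 4) * (36 * ‖z‖ₑ ^ 4 * energy z) := by
        rw [ENNReal.tsum_mul_left]
        gcongr
    _ = _ := by ring

theorem energy_sexticField_le (hρ : 0 ≤ ρ) (hc : ∀ p, ‖c p‖ₑ ≤ 1) (z : PhaseSpace ρ) :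
    energy (sexticField c z) ≤ 2592 * ‖z‖ₑ ^ 8 * energy z := by
  rw [energy_eq_add]
  refine (add_le_add (tsum_coord_sexticField_sq_le hρ hc _ z)
    (tsum_coord_sexticField_sq_le hρ hc _ z)).trans (le_of_eq ?_)
  ring

/-! ### The quadratic Hamiltonian along a sextic vector field -/

/-- At points of finite energy the monomials remain summable after multiplication by the square of
the integer in one slot: one of its two factors is moved to another slot by the conservation of
momentum. -/
theorem tsum_sq_mul_monomial_ne_top (hρ : 0 ≤ ρ) (s : Slot) {z : PhaseSpace ρ}
    (hz : FiniteEnergy z) :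
    ∑' p : zeroMomentum, ‖(slotIndex p.1 s : ℝ)‖ₑ ^ 2 * ‖monomial p.1 z‖ₑ ≠ ⊤ := by
  rw [finiteEnergy_iff] at hz
  set g : Slot → ℤ → ℝ≥0∞ := fun t k => (‖(k : ℝ)‖ₑ * ‖coord ρ t k z‖ₑ) ^ 2 with hg
  have h : ∀ s t : Slot, t ≠ s → ∑' p : zeroMomentum, g t (slotIndex p.1 t) *
      ∏ r ∈ (univ.erase s).erase t, ‖coord ρ r (slotIndex p.1 r) z‖ₑ ≠ ⊤ := fun s t hts =>
    ne_top_of_le_ne_top (ENNReal.mul_ne_top hz (by simp))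
      ((tsum_mul_prod_erase_erase_le hρ hts (g t) z).trans
        (mul_le_mul_left (enorm_mul_coord_sq_le_energy t z) _))
  refine ne_top_of_le_ne_top (b := ∑ t ∈ univ.erase s, ∑' p : zeroMomentum,
    (g t (slotIndex p.1 t) * ∏ r ∈ (univ.erase s).erase t, ‖coord ρ r (slotIndex p.1 r) z‖ₑ +
    g s (slotIndex p.1 s) * ∏ r ∈ (univ.erase t).erase s, ‖coord ρ r (slotIndex p.1 r) z‖ₑ)) ?_ ?_
  · refine (ENNReal.sum_ne_top).2 fun t ht => ?_
    rw [ENNReal.tsum_add]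
    exact ENNReal.add_ne_top.2 ⟨h s t (ne_of_mem_erase ht), h t s (ne_of_mem_erase ht).symm⟩
  · rw [← Summable.tsum_finsetSum fun _ _ => ENNReal.summable]
    refine ENNReal.tsum_le_tsum fun p => ?_
    have hm : ‖monomial p.1 z‖ₑ = ∏ r, ‖coord ρ r (slotIndex p.1 r) z‖ₑ := by
      rw [monomial_eq_prod]
      simp only [enorm_eq_nnnorm, nnnorm_prod, ENNReal.ofNNReal_finsetProd]
    rw [sq, mul_assoc]
    refine (mul_le_mul_left (enorm_slotIndex_le p s) _).trans ?_
    rw [sum_mul]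
    refine sum_le_sum fun t ht => ?_
    rw [hm, ← mul_prod_erase _ _ (mem_univ s), ← mul_prod_erase _ _ ht,
      erase_right_comm (a := t), ← add_mul]
    set Q := ∏ r ∈ (univ.erase s).erase t, ‖coord ρ r (slotIndex p.1 r) z‖ₑ
    set a := ‖(slotIndex p.1 t : ℝ)‖ₑ
    set a' := ‖(slotIndex p.1 s : ℝ)‖ₑ
    set b := ‖coord ρ t (slotIndex p.1 t) z‖ₑ
    set b' := ‖coord ρ s (slotIndex p.1 s) z‖ₑ
    calc a * (a' * (b' * (b * Q))) = ((a * b) * (a' * b')) * Q := by ring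
      _ ≤ (2 * ((a * b) * (a' * b'))) * Q := by
        refine mul_le_mul_left ?_ Q
        rw [two_mul]
        exact le_self_add
      _ ≤ _ := by
        gcongr
        exact ennreal_two_mul_le_add_sq _ _

/-- The polarization of the terms of `hamN`. -/
def pairing (v : PhaseSpace ρ) (j : ℤ) : PhaseSpace ρ →L[ℂ] ℂ :=
  v.xi j • coord ρ (Sum.inr 0) j + v.eta j • coord ρ (Sum.inl 0) j

theorem pairing_apply (v u : PhaseSpace ρ) (j : ℤ) :
    pairing v j u = v.xi j * u.eta j + v.eta j * u.xi j := rfl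

theorem pairing_dualVec (v : PhaseSpace ρ) (s : Slot) (j k : ℤ) :
    pairing v j (dualVec ρ s k) =
      if k = j then Complex.I * slotSign s * coord ρ s k v else 0 := by
  rw [pairing_apply]
  rcases eq_or_ne k j with rfl | h
  · rcases s with s | s <;>
      simp [-neg_smul, dualVec, slotSign, xi_smul, eta_smul, xi_xiVec, eta_xiVec, xi_etaVec,
        eta_etaVec, mul_comm]
  · rcases s with s | s <;>
      simp [-neg_smul, dualVec, xi_smul, eta_smul, xi_xiVec, eta_xiVec, xi_etaVec, eta_etaVec, h,
        h.symm]

theorem hasSum_pairing_slotField (hρ : 0 ≤ ρ) (hc : ∀ p, ‖c p‖ₑ ≤ 1) (s : Slot)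
    {z : PhaseSpace ρ} (hz : FiniteEnergy z) :
    Summable (fun p : zeroMomentum =>
      Complex.I * slotSign s * (slotIndex p.1 s : ℂ) ^ 2 * (c p * monomial p.1 z)) ∧
    HasSum (fun j : ℤ => (j : ℂ) ^ 2 * pairing z j (slotField c s z))
      (∑' p : zeroMomentum,
        Complex.I * slotSign s * (slotIndex p.1 s : ℂ) ^ 2 * (c p * monomial p.1 z)) := by
  set f : zeroMomentum → ℂ := fun p =>
    Complex.I * slotSign s * (slotIndex p.1 s : ℂ) ^ 2 * (c p * monomial p.1 z) with hf
  have hI : ‖Complex.I‖ₑ = 1 := by simp [enorm_eq_nnnorm]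
  have hsgn : ‖(slotSign s : ℂ)‖ₑ = 1 := by
    rcases s with s | s <;> simp [slotSign]
  have hfs : Summable f := by
    refine Summable.of_enorm (ne_top_of_le_ne_top (tsum_sq_mul_monomial_ne_top hρ s hz)
      (ENNReal.tsum_le_tsum fun p => ?_))
    have h : ‖(slotIndex p.1 s : ℂ)‖ₑ = ‖(slotIndex p.1 s : ℝ)‖ₑ := by
      rw [← ofReal_norm, ← ofReal_norm]
      simp
    simp only [hf, enorm_mul, enorm_pow, hI, hsgn, h, one_mul]
    gcongr
    exact mul_le_of_le_one_left' (hc p)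
  refine ⟨hfs, (hfs.hasSum.tsum_fiberwise fun p => slotIndex p.1 s).congr_fun fun j => ?_⟩
  rw [_root_.tsum_subtype, ← ((hasSum_slotField hρ hc s z).mapL (pairing z j)).tsum_eq,
    ← tsum_mul_left]
  refine tsum_congr fun p => ?_
  rw [map_smul, pairing_dualVec, smul_eq_mul]
  by_cases hj : slotIndex p.1 s = j
  · rw [if_pos hj, Set.indicator_of_mem (by exact hj)]
    simp only [hf, monomial_eq_prod, hj, ← mul_prod_erase _ _ (mem_univ s)]
    ring
  · rw [if_neg hj, Set.indicator_of_notMem (by exact hj), mul_zero, mul_zero]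

/-- The derivative of `hamN` along the vector field of a sextic Hamiltonian multiplies each monomial
by `i` times its divisor. -/
theorem hasSum_pairing_sexticField (hρ : 0 ≤ ρ) (hc : ∀ p, ‖c p‖ₑ ≤ 1)
    {z : PhaseSpace ρ} (hz : FiniteEnergy z) :
    HasSum (fun j : ℤ => (j : ℂ) ^ 2 * pairing z j (sexticField c z))
      (∑' p : zeroMomentum, Complex.I * divisor p.1 * (c p * monomial p.1 z)) := by
  have h := hasSum_sum fun s (_ : s ∈ univ) => (hasSum_pairing_slotField hρ hc s hz).2
  rw [← Summable.tsum_finsetSum fun s _ => (hasSum_pairing_slotField hρ hc s hz).1] at h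
  have hval : ∀ p : zeroMomentum, Complex.I * divisor p.1 * (c p * monomial p.1 z) =
      ∑ s, Complex.I * slotSign s * (slotIndex p.1 s : ℂ) ^ 2 * (c p * monomial p.1 z) :=
      fun p => by
    rw [divisor_eq_sum, ← sum_mul]
    push_cast
    rw [mul_sum]
    congr 1
    exact sum_congr rfl fun s _ => by ring
  simp_rw [hval]
  refine h.congr_fun fun j => ?_
  rw [sexticField, map_sum, mul_sum]

theorem summable_hamN {z : PhaseSpace ρ} (hz : FiniteEnergy z) :
    Summable fun j : ℤ => (j : ℂ) ^ 2 * (z.xi j * z.eta j) := by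
  refine Summable.of_norm_bounded hz fun j => ?_
  rw [norm_mul, norm_mul, norm_pow, Complex.norm_intCast, sq_abs]
  gcongr
  nlinarith [sq_nonneg (‖z.xi j‖ - ‖z.eta j‖), sq_nonneg ‖z.xi j‖, sq_nonneg ‖z.eta j‖]

/-- `hamN` is quadratic, so its increment between `m - x / 2` and `m + x / 2` is its derivative at
the midpoint `m` in the direction `x`. -/
theorem hamN_sub_hamN {m x : PhaseSpace ρ} (h1 : FiniteEnergy (m + (1 / 2 : ℂ) • x))
    (h2 : FiniteEnergy (m - (1 / 2 : ℂ) • x)) :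
    hamN (m + (1 / 2 : ℂ) • x) - hamN (m - (1 / 2 : ℂ) • x) =
      ∑' j : ℤ, (j : ℂ) ^ 2 * pairing m j x := by
  rw [hamN, hamN, ← (summable_hamN h1).tsum_sub (summable_hamN h2)]
  refine tsum_congr fun j => ?_
  rw [pairing_apply, xi_add, eta_add, xi_sub, eta_sub, xi_smul, eta_smul]
  ring

/-! ### The homological equation -/

/-- The coefficients of `hamP`. -/
def coeffP : zeroMomentum → ℂ := fun _ => 1 / 3

open Classical in
/-- The coefficients of `hamZ6`. -/
def coeffZ : zeroMomentum → ℂ := fun p => if divisor p.1 = 0 then 1 / 3 else 0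

/-- The coefficients of the generating Hamiltonian, which solves the homological equation. Division
by zero gives the value `0` at the resonant indices. -/
def coeffChi : zeroMomentum → ℂ := fun p => Complex.I / (3 * divisor p.1)

theorem enorm_le_one_of_norm {x : ℂ} (h : ‖x‖ ≤ 1) : ‖x‖ₑ ≤ 1 := by
  rw [← ofReal_norm]
  exact ENNReal.ofReal_le_one.2 h

theorem enorm_coeffP_le (p : zeroMomentum) : ‖coeffP p‖ₑ ≤ 1 :=
  enorm_le_one_of_norm (by norm_num [coeffP])

theorem enorm_coeffZ_le (p : zeroMomentum) : ‖coeffZ p‖ₑ ≤ 1 := by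
  refine enorm_le_one_of_norm ?_
  rw [coeffZ]
  split_ifs <;> norm_num

theorem enorm_coeffChi_le (p : zeroMomentum) : ‖coeffChi p‖ₑ ≤ 1 := by
  refine enorm_le_one_of_norm ?_
  rw [coeffChi, norm_div, Complex.norm_I, norm_mul, Complex.norm_intCast]
  by_cases h : divisor p.1 = 0
  · simp [h]
  · have h1 : (1 : ℝ) ≤ |(divisor p.1 : ℝ)| := by exact_mod_cast Int.one_le_abs h
    have h3 : ‖(3 : ℂ)‖ = 3 := by norm_num
    rw [h3]
    exact div_le_one_of_le₀ (by linarith) (by positivity)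

theorem hamP_eq_sextic : hamP (ρ := ρ) = sextic coeffP := by
  funext z
  rw [hamP, sextic, ← tsum_mul_left]
  rfl

theorem hamZ6_eq_sextic : hamZ6 (ρ := ρ) = sextic coeffZ := by
  funext z
  rw [hamZ6, sextic, ← tsum_mul_left,
    _root_.tsum_subtype resonant fun p : SexticIndex => 1 / 3 * monomial p z]
  have h : ∀ p : zeroMomentum, coeffZ p * monomial p.1 z =
      (fun q : SexticIndex => (if divisor q = 0 then 1 / 3 else 0) * monomial q z) p.1 :=
      fun p => by
    simp only [coeffZ]
  rw [tsum_congr h, _root_.tsum_subtype zeroMomentum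
    fun q : SexticIndex => (if divisor q = 0 then 1 / 3 else 0) * monomial q z]
  refine tsum_congr fun p => ?_
  simp only [Set.indicator_apply, resonant, zeroMomentum, Set.mem_ofPred_eq, ite_and, ite_mul,
    zero_mul]

/-- The homological equation `dN · X_χ = Z₆ - P` at the points of finite energy. -/
theorem tsum_pairing_sexticField_coeffChi (hρ : 0 ≤ ρ) {z : PhaseSpace ρ} (hz : FiniteEnergy z) :
    ∑' j : ℤ, (j : ℂ) ^ 2 * pairing z j (sexticField coeffChi z) = hamZ6 z - hamP z := by
  rw [(hasSum_pairing_sexticField hρ enorm_coeffChi_le hz).tsum_eq, hamZ6_eq_sextic,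
    hamP_eq_sextic, sextic, sextic, ← (summable_sextic hρ enorm_coeffZ_le z).tsum_sub
    (summable_sextic hρ enorm_coeffP_le z)]
  refine tsum_congr fun p => ?_
  rw [coeffChi, coeffZ, coeffP]
  by_cases h : divisor p.1 = 0
  · simp [h]
  · have h' : (divisor p.1 : ℂ) ≠ 0 := by exact_mod_cast h
    rw [if_neg h]
    field_simp
    rw [Complex.I_sq]
    ring

/-! ### Maps close to the identity -/

section NearIdentity

variable {E : Type*} [NormedAddCommGroup E]


/-- The equation `m = z + g m` is solved by a contraction; its solution belongs to every closed set
that contains `0` and is preserved by the iteration. -/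
theorem exists_solution_mem [CompleteSpace E] {g : E → E} (h0 : g 0 = 0) {δ : ℝ}
    (hlip : ∀ a ∈ Metric.ball (0 : E) δ, ∀ b ∈ Metric.ball (0 : E) δ,
      ‖g a - g b‖ ≤ 1 / 4 * ‖a - b‖) {z : E} (hz : 2 * ‖z‖ < δ) {S : Set E} (hS : IsClosed S)
    (hS0 : (0 : E) ∈ S) (hSg : ∀ u ∈ S, ‖u‖ ≤ 2 * ‖z‖ → z + g u ∈ S) :
    ∃ m ∈ S, ‖m‖ ≤ 2 * ‖z‖ ∧ m = z + g m := by
  have hball : ∀ u : E, ‖u‖ ≤ 2 * ‖z‖ → u ∈ Metric.ball (0 : E) δ := fun u hu => by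
    rw [mem_ball_zero_iff]
    linarith
  have h0b : ‖(0 : E)‖ ≤ 2 * ‖z‖ := by simp
  set s : Set E := S ∩ Metric.closedBall 0 (2 * ‖z‖) with hs
  have hmaps : Set.MapsTo (fun u => z + g u) s s := by
    rintro u ⟨huS, hu⟩
    rw [mem_closedBall_zero_iff] at hu
    refine ⟨hSg u huS hu, ?_⟩
    rw [mem_closedBall_zero_iff]
    have h1 := hlip u (hball u hu) 0 (hball 0 h0b)
    rw [h0, sub_zero, sub_zero] at h1
    have h2 := norm_add_le z (g u)
    linarith [norm_nonneg z]
  have hcontr : ContractingWith (1 / 4) (hmaps.restrict (fun u => z + g u) s s) := by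
    refine ⟨by rw [← NNReal.coe_lt_coe]; norm_num, LipschitzWith.of_dist_le_mul fun a b => ?_⟩
    rw [Subtype.dist_eq, Subtype.dist_eq, dist_eq_norm, dist_eq_norm]
    have ha := mem_closedBall_zero_iff.1 a.2.2
    have hb := mem_closedBall_zero_iff.1 b.2.2
    have h := hlip a (hball a ha) b (hball b hb)
    simpa using h
  obtain ⟨m, hm, hfix, -⟩ := ContractingWith.exists_fixedPoint'
    (hS.inter Metric.isClosed_closedBall).isComplete hmaps hcontr (x := 0)
    ⟨hS0, mem_closedBall_zero_iff.2 h0b⟩ (edist_ne_top _ _)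
  exact ⟨m, hm.1, mem_closedBall_zero_iff.1 hm.2, hfix.symm⟩

variable [NormedSpace ℂ E]

theorem exists_equiv_of_norm_le [CompleteSpace E] {T : E →L[ℂ] E} (hT : ‖T‖ ≤ 1 / 4) :
    ∃ J : E ≃L[ℂ] E, ∀ v, J v = v + T v := by
  have h : ‖-T‖ < 1 := by rw [norm_neg]; linarith
  refine ⟨ContinuousLinearEquiv.ofUnit (Units.oneSub (-T) h), fun v => ?_⟩
  show ((Units.oneSub (-T) h : (E →L[ℂ] E)ˣ) : E →L[ℂ] E) v = _
  simp

theorem norm_fderiv_le_of_lipschitz_ball {g : E → E} (hg : Differentiable ℂ g) {δ : ℝ}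
    (hlip : ∀ a ∈ Metric.ball (0 : E) δ, ∀ b ∈ Metric.ball (0 : E) δ,
      ‖g a - g b‖ ≤ 1 / 4 * ‖a - b‖) {m : E} (hm : m ∈ Metric.ball (0 : E) δ) :
    ‖fderiv ℂ g m‖ ≤ 1 / 4 :=
  (hg m).hasFDerivAt.le_of_lip' (by norm_num) <|
    Filter.mem_of_superset (Metric.isOpen_ball.mem_nhds hm) fun x hx => hlip x hx m hm

theorem exists_openPartialHomeomorph_nearIdentity [CompleteSpace E]
    {g : E → E} (hg : ContDiff ℂ ∞ g) {δ : ℝ}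
    (hlip : ∀ a ∈ Metric.ball (0 : E) δ, ∀ b ∈ Metric.ball (0 : E) δ,
      ‖g a - g b‖ ≤ 1 / 4 * ‖a - b‖) :
    ∃ h : OpenPartialHomeomorph E E, h.source = Metric.ball 0 δ ∧ (∀ m, h m = m + g m) ∧
      ∀ z ∈ h.target, ContDiffAt ℂ ∞ h.symm z ∧
        ∃ J : E ≃L[ℂ] E, (∀ v, J v = v + fderiv ℂ g (h.symm z) v) ∧
          HasFDerivAt h.symm (J.symm : E →L[ℂ] E) z := by
  have hdiff : Differentiable ℂ g := hg.differentiable (by simp)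
  have happ : ApproximatesLinearOn (fun m => m + g m)
      ((ContinuousLinearEquiv.refl ℂ E : E ≃L[ℂ] E) : E →L[ℂ] E) (Metric.ball 0 δ) (1 / 4) := by
    intro a ha b hb
    have h : a + g a - (b + g b) - (a - b) = g a - g b := by abel
    simpa [h] using hlip a ha b hb
  have hc : Subsingleton E ∨ (1 / 4 : NNReal) <
      ‖((ContinuousLinearEquiv.refl ℂ E).symm : E →L[ℂ] E)‖₊⁻¹ := by
    rcases subsingleton_or_nontrivial E with h | h
    · exact Or.inl h
    · right
      have h1 : ‖((ContinuousLinearEquiv.refl ℂ E).symm : E →L[ℂ] E)‖₊ = 1 :=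
        ContinuousLinearMap.nnnorm_id
      rw [h1, inv_one]
      rw [← NNReal.coe_lt_coe]
      norm_num
  set h := happ.toOpenPartialHomeomorph _ _ hc Metric.isOpen_ball with hh
  have hcoe : ⇑h = fun m => m + g m := rfl
  refine ⟨h, rfl, fun m => rfl, fun z hz => ?_⟩
  have hm : h.symm z ∈ Metric.ball (0 : E) δ := h.map_target hz
  obtain ⟨J, hJ⟩ := exists_equiv_of_norm_le (norm_fderiv_le_of_lipschitz_ball hdiff hlip hm)
  have hJd : HasFDerivAt h (J : E →L[ℂ] E) (h.symm z) := by
    rw [hcoe]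
    refine ((hasFDerivAt_id _).fun_add (hdiff _).hasFDerivAt).congr_fderiv ?_
    ext v
    exact (hJ v).symm
  refine ⟨h.contDiffAt_symm hz hJd ?_, J, hJ, h.hasFDerivAt_symm hz hJd⟩
  rw [hcoe]
  exact (contDiff_id.add hg).contDiffAt

theorem norm_fderiv_le_of_lipschitz {X : E → E} (hX : Differentiable ℂ X) {K : ℝ} (hK0 : 0 ≤ K)
    (hK : ∀ a b, ‖X a - X b‖ ≤ K * max ‖a‖ ‖b‖ ^ 4 * ‖a - b‖) (m : E) :
    ‖fderiv ℂ X m‖ ≤ K * ‖m‖ ^ 4 := by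
  have hlim : Filter.Tendsto (fun r : ℝ => K * r ^ 4) (nhdsWithin ‖m‖ (Set.Ioi ‖m‖))
      (nhds (K * ‖m‖ ^ 4)) :=
    (Continuous.tendsto (by fun_prop) _).mono_left nhdsWithin_le_nhds
  refine ge_of_tendsto hlim (Filter.mem_of_superset self_mem_nhdsWithin fun r hr => ?_)
  have hr : ‖m‖ < r := hr
  have hr0 : 0 ≤ r := (norm_nonneg m).trans hr.le
  refine (hX m).hasFDerivAt.le_of_lip' (by positivity) ?_
  have hmem : m ∈ Metric.ball (0 : E) r := mem_ball_zero_iff.2 hr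
  refine Filter.mem_of_superset (Metric.isOpen_ball.mem_nhds hmem) fun x hx => ?_
  refine (hK x m).trans ?_
  gcongr
  exact max_le (mem_ball_zero_iff.1 hx).le hr.le

end NearIdentity

/-! ### The implicit midpoint map -/

theorem energy_zero : energy (0 : PhaseSpace ρ) = 0 := by
  have h := energy_smul (0 : ℂ) (0 : PhaseSpace ρ)
  rwa [zero_smul, enorm_zero, zero_pow two_ne_zero, zero_mul] at h

theorem FiniteEnergy.add {z w : PhaseSpace ρ} (hz : FiniteEnergy z) (hw : FiniteEnergy w) :
    FiniteEnergy (z + w) := by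
  rw [finiteEnergy_iff] at *
  exact ne_top_of_le_ne_top (ENNReal.mul_ne_top (by simp) (ENNReal.add_ne_top.2 ⟨hz, hw⟩))
    (energy_add_le z w)

theorem FiniteEnergy.sexticField (hρ : 0 ≤ ρ) {c : zeroMomentum → ℂ} (hc : ∀ p, ‖c p‖ₑ ≤ 1)
    {z : PhaseSpace ρ} (hz : FiniteEnergy z) : FiniteEnergy (sexticField c z) := by
  rw [finiteEnergy_iff] at *
  exact ne_top_of_le_ne_top (ENNReal.mul_ne_top (ENNReal.mul_ne_top (by simp) (by simp)) hz)
    (energy_sexticField_le hρ hc z)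

/-- The iteration that defines the midpoint keeps the energy bounded by four times that of the
starting point. -/
theorem energy_iteration_le (hρ : 0 ≤ ρ) {c : zeroMomentum → ℂ} (hc : ∀ p, ‖c p‖ₑ ≤ 1)
    {z u : PhaseSpace ρ} (hu : ‖u‖ ≤ 1 / 4) (hE : energy u ≤ 4 * energy z) :
    energy (z + (1 / 2 : ℂ) • sexticField c u) ≤ 4 * energy z := by
  have hu' : ‖u‖ₑ ≤ ENNReal.ofReal (1 / 4) := by
    rw [← ofReal_norm]
    exact ENNReal.ofReal_le_ofReal hu
  have hnum : 2592 * ENNReal.ofReal (1 / 4) ^ 8 * 4 ≤ 1 := by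
    rw [← ENNReal.ofReal_pow (by norm_num), ← ENNReal.ofReal_ofNat 2592,
      ← ENNReal.ofReal_ofNat 4, ← ENNReal.ofReal_mul (by norm_num),
      ← ENNReal.ofReal_mul (by norm_num), ENNReal.ofReal_le_one]
    norm_num
  have hhalf : ‖(1 / 2 : ℂ)‖ₑ ^ 2 ≤ 1 :=
    pow_le_one' (enorm_le_one_of_norm (by norm_num)) 2
  calc energy (z + (1 / 2 : ℂ) • sexticField c u)
      ≤ 2 * (energy z + ‖(1 / 2 : ℂ)‖ₑ ^ 2 * energy (sexticField c u)) := by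
        rw [← energy_smul]
        exact energy_add_le _ _
    _ ≤ 2 * (energy z + 1 * (2592 * ENNReal.ofReal (1 / 4) ^ 8 * (4 * energy z))) := by
        gcongr
        refine (energy_sexticField_le hρ hc u).trans ?_
        gcongr
    _ = 2 * (energy z + (2592 * ENNReal.ofReal (1 / 4) ^ 8 * 4) * energy z) := by ring
    _ ≤ 2 * (energy z + 1 * energy z) := by gcongr
    _ = 4 * energy z := by ring

/-- For the symplectic form, the adjoint of `1 - κ A` with `A` skew is `1 + κ A`. -/
theorem symp_adjoint (hρ : 0 ≤ ρ) {A : PhaseSpace ρ →L[ℂ] PhaseSpace ρ}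
    (hA : ∀ u v, symp hρ (A u) v = -symp hρ u (A v)) (κ : ℂ) (u v : PhaseSpace ρ) :
    symp hρ (u + (-κ) • A u) v = symp hρ u (v + κ • A v) := by
  simp only [map_add, map_smul, add_apply, smul_apply,
    smul_eq_mul, hA]
  ring

/-- The implicit midpoint map `τ` of the generating vector field `X`, with the midpoint `μ z` of `z`
and `τ z`: on a small ball it is a diffeomorphism onto its image, close to the identity, and `μ`
preserves finite energy. -/
theorem exists_midpointMap (hρ : 0 ≤ ρ) {c : zeroMomentum → ℂ} (hc : ∀ p, ‖c p‖ₑ ≤ 1) :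
    ∃ δ > (0 : ℝ), δ ≤ 1 ∧ ∀ ε : ℝ, 0 < ε → ε ≤ δ →
      ∃ (τ : OpenPartialHomeomorph (PhaseSpace ρ) (PhaseSpace ρ))
        (μ : PhaseSpace ρ → PhaseSpace ρ),
        τ.source = Metric.ball 0 ε ∧ τ.target ⊆ Metric.ball 0 (2 * ε) ∧
        ContDiffOn ℂ ∞ τ τ.source ∧ ContDiffOn ℂ ∞ τ.symm τ.target ∧
        (∀ z, τ z = μ z + (1 / 2 : ℂ) • sexticField c (μ z)) ∧
        ∀ z ∈ Metric.ball (0 : PhaseSpace ρ) ε,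
          z = μ z - (1 / 2 : ℂ) • sexticField c (μ z) ∧
          ‖μ z‖ ≤ 2 * ‖z‖ ∧ ‖τ z‖ ≤ 2 * ‖z‖ ∧
          (FiniteEnergy z → FiniteEnergy (μ z)) ∧
          ContDiffAt ℂ ∞ μ z ∧
          ‖fderiv ℂ (sexticField c) (μ z)‖ ≤ 1 / 2 ∧
          ∃ J : PhaseSpace ρ ≃L[ℂ] PhaseSpace ρ,
            (∀ v, J v = v + (-(1 / 2) : ℂ) • fderiv ℂ (sexticField c) (μ z) v) ∧
            HasFDerivAt μ (J.symm : PhaseSpace ρ →L[ℂ] PhaseSpace ρ) z := by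
  obtain ⟨K, hK0, hKX⟩ := exists_lipschitz_sexticField (ρ := ρ) hρ hc
  set X : PhaseSpace ρ → PhaseSpace ρ := sexticField c
  have hXc : ContDiff ℂ ∞ X := contDiff_sexticField hρ hc
  have hXd : Differentiable ℂ X := hXc.differentiable (by simp)
  have hX0 : X 0 = 0 := sexticField_zero
  -- on the ball of radius `δ` the maps `m ↦ m ± X m / 2` are `1 / 4`-Lipschitz perturbations of the
  -- identity; `δ ≤ 1 / 4` is what `energy_iteration_le` needs
  set δ : ℝ := 1 / (4 * (K + 1)) with hδ
  have hδ0 : 0 < δ := by positivity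
  have hδ4 : δ ≤ 1 / 4 := by
    rw [hδ]
    exact one_div_le_one_div_of_le (by norm_num) (by linarith)
  have hKδ : K * δ ^ 4 ≤ 1 / 2 := by
    have h1 : K * δ ≤ 1 / 4 := by
      rw [hδ, mul_one_div, div_le_iff₀ (by positivity)]
      linarith
    calc K * δ ^ 4 = K * δ * δ ^ 3 := by ring
      _ ≤ 1 / 4 * 1 := by
        gcongr
        exact pow_le_one₀ hδ0.le (by linarith)
      _ ≤ 1 / 2 := by norm_num
  have hlip : ∀ κ : ℂ, ‖κ‖ = 1 / 2 → ∀ a ∈ Metric.ball (0 : PhaseSpace ρ) δ,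
      ∀ b ∈ Metric.ball (0 : PhaseSpace ρ) δ, ‖κ • X a - κ • X b‖ ≤ 1 / 4 * ‖a - b‖ := by
    intro κ hκ a ha b hb
    rw [mem_ball_zero_iff] at ha hb
    rw [← smul_sub, norm_smul, hκ]
    have h1 : K * max ‖a‖ ‖b‖ ^ 4 * ‖a - b‖ ≤ 1 / 2 * ‖a - b‖ := by
      gcongr
      refine le_trans ?_ hKδ
      gcongr
      exact max_le ha.le hb.le
    linarith [hKX a b]
  have hn1 : ‖(1 / 2 : ℂ)‖ = 1 / 2 := by norm_num
  have hn2 : ‖(-(1 / 2) : ℂ)‖ = 1 / 2 := by norm_num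
  obtain ⟨hp, hps, hpe, hpt⟩ := exists_openPartialHomeomorph_nearIdentity
    (hXc.const_smul (1 / 2 : ℂ)) (hlip _ hn1)
  obtain ⟨hm, hms, hme, hmt⟩ := exists_openPartialHomeomorph_nearIdentity
    (hXc.const_smul (-(1 / 2) : ℂ)) (hlip _ hn2)
  have hfd : ∀ (κ : ℂ) (x v : PhaseSpace ρ),
      fderiv ℂ (fun m => κ • X m) x v = κ • fderiv ℂ X x v := fun κ x v => by
    rw [((hXd x).hasFDerivAt.fun_const_smul κ).fderiv]
    rfl
  -- the midpoint `m` and its bounds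
  have hmid : ∀ z : PhaseSpace ρ, 2 * ‖z‖ < δ → ∀ S : Set (PhaseSpace ρ), IsClosed S → 0 ∈ S →
      (∀ u ∈ S, ‖u‖ ≤ 2 * ‖z‖ → z + (1 / 2 : ℂ) • X u ∈ S) →
      z ∈ hm.target ∧ hm.symm z ∈ S ∧ ‖hm.symm z‖ ≤ 2 * ‖z‖ := by
    intro z hz S hS hS0 hSg
    obtain ⟨m, hmS, hmz, hfix⟩ := exists_solution_mem (g := fun u => (1 / 2 : ℂ) • X u)
      (by simp [hX0]) (hlip _ hn1) hz hS hS0 hSg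
    have hmsrc : m ∈ hm.source := by
      rw [hms, mem_ball_zero_iff]
      linarith
    have hmval : hm m = z := by
      rw [hme, neg_smul, ← sub_eq_add_neg, sub_eq_iff_eq_add]
      exact hfix
    have hmsymm : hm.symm z = m := by rw [← hmval, hm.left_inv hmsrc]
    rw [hmsymm]
    exact ⟨hmval ▸ hm.map_source hmsrc, hmS, hmz⟩
  refine ⟨δ / 2, by positivity, by linarith, fun ε hε hε0 => ?_⟩
  have hsmall : ∀ z ∈ Metric.ball (0 : PhaseSpace ρ) ε, 2 * ‖z‖ < δ := fun z hz => by
    have := mem_ball_zero_iff.1 hz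
    linarith
  have hmid' : ∀ z ∈ Metric.ball (0 : PhaseSpace ρ) ε, z ∈ hm.target ∧ ‖hm.symm z‖ ≤ 2 * ‖z‖ :=
    fun z hz => by
      obtain ⟨h1, -, h2⟩ := hmid z (hsmall z hz) Set.univ isClosed_univ trivial fun _ _ _ => trivial
      exact ⟨h1, h2⟩
  set τ := (hm.symm.trans hp).restrOpen (Metric.ball 0 ε) Metric.isOpen_ball
  have hτe : ∀ z, τ z = hp (hm.symm z) := fun _ => rfl
  have hτs : ∀ w, τ.symm w = hm (hp.symm w) := fun _ => rfl
  have hsrc : τ.source = Metric.ball 0 ε := by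
    ext z
    constructor
    · exact fun h => h.2
    · intro hz
      refine ⟨⟨(hmid' z hz).1, ?_⟩, hz⟩
      show hm.symm z ∈ hp.source
      rw [hps, ← hms]
      exact hm.map_target (hmid' z hz).1
  have htgt : τ.target ⊆ hp.target := fun w hw => hw.1.1
  have hzm : ∀ z ∈ Metric.ball (0 : PhaseSpace ρ) ε,
      z = hm.symm z - (1 / 2 : ℂ) • X (hm.symm z) := fun z hz => by
    have h := hm.right_inv (hmid' z hz).1
    rw [hme, neg_smul, ← sub_eq_add_neg] at h
    exact h.symm
  have hτm : ∀ z, τ z = hm.symm z + (1 / 2 : ℂ) • X (hm.symm z) := fun z => by rw [hτe, hpe]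
  have htgt2 : ∀ z ∈ Metric.ball (0 : PhaseSpace ρ) ε, ‖τ z‖ ≤ 2 * ‖z‖ := fun z hz => by
    have h1 := (hmid' z hz).2
    have h2 : τ z = z + (2 : ℂ) • ((1 / 2 : ℂ) • X (hm.symm z)) := by
      rw [hτm, two_smul, ← add_assoc]
      congr 1
      exact (eq_sub_iff_add_eq.1 (hzm z hz)).symm
    have h3 := hlip _ hn1 (hm.symm z) (mem_ball_zero_iff.2 (h1.trans_lt (hsmall z hz))) 0
      (Metric.mem_ball_self hδ0)
    rw [hX0, smul_zero, sub_zero, sub_zero] at h3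
    have h4 : ‖(2 : ℂ) • ((1 / 2 : ℂ) • X (hm.symm z))‖ =
        2 * ‖(1 / 2 : ℂ) • X (hm.symm z)‖ := by
      rw [norm_smul]
      norm_num
    rw [h2]
    linarith [norm_add_le z ((2 : ℂ) • ((1 / 2 : ℂ) • X (hm.symm z)))]
  refine ⟨τ, hm.symm, hsrc, ?_, ?_, ?_, hτm, fun z hz => ?_⟩
  · intro w hw
    have h1 : τ.symm w ∈ Metric.ball (0 : PhaseSpace ρ) ε := hsrc ▸ τ.map_target hw
    have h2 := htgt2 _ h1
    rw [τ.right_inv hw] at h2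
    rw [mem_ball_zero_iff] at h1 ⊢
    linarith
  · intro z hz
    rw [hsrc] at hz
    have h := (hmt z (hmid' z hz).1).1
    exact ((h.add ((hXc.contDiffAt.comp z h).const_smul (1 / 2 : ℂ))).congr_of_eventuallyEq
      (Filter.Eventually.of_forall hτm)).contDiffWithinAt
  · intro w hw
    have h := (hpt w (htgt hw)).1
    refine ((h.add ((hXc.contDiffAt.comp w h).const_smul (-(1 / 2) : ℂ))).congr_of_eventuallyEq
      (Filter.Eventually.of_forall fun w => ?_)).contDiffWithinAt
    rw [hτs, hme]
    rfl
  · obtain ⟨hcd, J, hJ, hJd⟩ := hmt z (hmid' z hz).1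
    refine ⟨hzm z hz, (hmid' z hz).2, htgt2 z hz, fun hE => ?_, hcd, ?_, J, fun v => ?_, hJd⟩
    · have h0 : (0 : PhaseSpace ρ) ∈ {u : PhaseSpace ρ | energy u ≤ 4 * energy z} := by
        show energy (0 : PhaseSpace ρ) ≤ _
        rw [energy_zero]
        exact zero_le
      have h := (hmid z (hsmall z hz) _ (isClosed_energy_le (4 * energy z)) h0
        fun u hu hu2 => energy_iteration_le hρ hc
          (by have := hsmall z hz; linarith) hu).2.1
      rw [finiteEnergy_iff] at hE ⊢
      exact ne_top_of_le_ne_top (ENNReal.mul_ne_top (by simp) hE) h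
    · refine (norm_fderiv_le_of_lipschitz hXd hK0 hKX _).trans (le_trans ?_ hKδ)
      gcongr
      exact (hmid' z hz).2.trans (hsmall z hz).le
    · rw [hJ, hfd]

/-! ### The vector field of the remainder -/

/-- The vector field of the remainder at `z`. Here `A` is the derivative of the generating vector
field at the midpoint `m`, so that `Jm⁻¹` and `Jp Jm⁻¹` are the derivatives of `m` and `w = τ z`
with respect to `z`; the vectors `zZ`, `mZ`, `mP`, `wP` are the values of the vector fields of
`Z₆` and `P` at `z`, `m`, `m`, `w`. The right-hand side is then the derivative of `Z₆(m) - Z₆(z) +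
(P(w) - P(m))` in the direction `v`, and `Jp⁻¹ (mZ - mP + Jm wP) - zZ` represents it, because `Jp`
and `Jm` are adjoint to each other for the symplectic form. The bound is read off from `Jp Y = (mZ
- zZ) + (wP - mP) - A (wP + zZ) / 2`. -/
theorem exists_remainder_vector (hρ : 0 ≤ ρ) {A : PhaseSpace ρ →L[ℂ] PhaseSpace ρ}
    (hA : ∀ u v, symp hρ (A u) v = -symp hρ u (A v)) {Jp Jm : PhaseSpace ρ ≃L[ℂ] PhaseSpace ρ}
    (hJp : ∀ v, Jp v = v + (1 / 2 : ℂ) • A v) (hJm : ∀ v, Jm v = v + (-(1 / 2) : ℂ) • A v)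
    (hA1 : ‖A‖ ≤ 1 / 2) {B D : ℝ} (hAB : ‖A‖ ≤ B)
    {zZ mZ mP wP : PhaseSpace ρ} (hzZ : ‖zZ‖ ≤ D) (hwP : ‖wP‖ ≤ D) {L : ℝ}
    (hZ : ‖mZ - zZ‖ ≤ L) (hP : ‖wP - mP‖ ≤ L) :
    ∃ Y : PhaseSpace ρ, ‖Y‖ ≤ 4 / 3 * (2 * L + B * D) ∧ ∀ v : PhaseSpace ρ,
      symp hρ v Y = symp hρ (Jm.symm v) mZ - symp hρ v zZ +
        (symp hρ (Jp (Jm.symm v)) wP - symp hρ (Jm.symm v) mP) := by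
  set y := mZ - mP + Jm wP with hy
  refine ⟨Jp.symm y - zZ, ?_, fun v => ?_⟩
  · set Y := Jp.symm y - zZ with hY
    have h1 : Jp Y = (mZ - zZ) + (wP - mP) + (-(1 / 2) : ℂ) • A (wP + zZ) := by
      rw [hY, map_sub, Jp.apply_symm_apply, hy, hJm, hJp, map_add, smul_add, neg_smul, neg_smul]
      abel
    have hhalf : ∀ x : PhaseSpace ρ, ‖(1 / 2 : ℂ) • x‖ = 1 / 2 * ‖x‖ := fun x => by
      rw [norm_smul]
      norm_num
    have h2 : ‖Jp Y‖ ≤ L + L + B * D := by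
      have h3 : ‖(-(1 / 2) : ℂ) • A (wP + zZ)‖ ≤ B * D := by
        rw [neg_smul, norm_neg, hhalf]
        have h4 : ‖A (wP + zZ)‖ ≤ B * (D + D) :=
          A.le_of_opNorm_le_of_le hAB ((norm_add_le _ _).trans (add_le_add hwP hzZ))
        linarith
      rw [h1]
      exact (norm_add_le _ _).trans (add_le_add ((norm_add_le _ _).trans (add_le_add hZ hP)) h3)
    have h5 : ‖Y‖ ≤ ‖Jp Y‖ + 1 / 4 * ‖Y‖ := by
      have h6 : Y = Jp Y - (1 / 2 : ℂ) • A Y := by rw [hJp]; abel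
      have h7 : ‖(1 / 2 : ℂ) • A Y‖ ≤ 1 / 4 * ‖Y‖ := by
        rw [hhalf]
        have := A.le_of_opNorm_le hA1 Y
        linarith
      have h8 := norm_sub_le (Jp Y) ((1 / 2 : ℂ) • A Y)
      rw [← h6] at h8
      linarith
    linarith
  · set u := Jm.symm v with hu
    have hv : v = Jm u := (Jm.apply_symm_apply v).symm
    have hadj : ∀ x, symp hρ (Jm u) x = symp hρ u (Jp x) := fun x => by
      rw [hJm, hJp, symp_adjoint hρ hA]
    have hadj' : ∀ x, symp hρ (Jp u) x = symp hρ u (Jm x) := fun x => by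
      rw [hJm, hJp, ← symp_adjoint hρ hA, neg_neg]
    rw [map_sub, hv, hadj (Jp.symm y), Jp.apply_symm_apply, hadj', hy, map_add, map_sub]
    ring

end QuinticNLS

end

open QuinticNLS in
theorem mainTheorem3 (ρ : ℝ) (hρ : 0 ≤ ρ) :
    ∃ ε₀ > (0 : ℝ), ∃ C : ℝ, ∀ ε : ℝ, 0 < ε → ε ≤ ε₀ →
      ∃ (τ : OpenPartialHomeomorph (QuinticNLS.PhaseSpace ρ) (QuinticNLS.PhaseSpace ρ))
        (R₁₀ : QuinticNLS.PhaseSpace ρ → ℂ)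
        (X : QuinticNLS.PhaseSpace ρ → QuinticNLS.PhaseSpace ρ),
        QuinticNLS.IsCanonicalChange τ (Metric.ball 0 ε) (Metric.ball 0 (2 * ε)) ∧
        (∀ z ∈ Metric.ball (0 : QuinticNLS.PhaseSpace ρ) ε, QuinticNLS.FiniteEnergy z →
          QuinticNLS.FiniteEnergy (τ z) ∧
          QuinticNLS.hamH (τ z) = QuinticNLS.hamN z + QuinticNLS.hamZ6 z + R₁₀ z) ∧
        ContDiffOn ℂ ∞ R₁₀ (Metric.ball 0 ε) ∧
        QuinticNLS.IsHamiltonianVectorField R₁₀ X (Metric.ball 0 ε) ∧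
        (∀ z ∈ Metric.ball (0 : QuinticNLS.PhaseSpace ρ) ε, ‖X z‖ ≤ C * ‖z‖ ^ 9) ∧
        (∀ z ∈ Metric.ball (0 : QuinticNLS.PhaseSpace ρ) ε, ‖τ z - z‖ ≤ C * ‖z‖ ^ 2) := by
  obtain ⟨K, hK0, hKX, hKP, hKZ⟩ : ∃ K : ℝ, 0 ≤ K ∧
      (∀ a b : PhaseSpace ρ, ‖sexticField coeffChi a - sexticField coeffChi b‖ ≤
        K * max ‖a‖ ‖b‖ ^ 4 * ‖a - b‖) ∧
      (∀ a b : PhaseSpace ρ, ‖sexticField coeffP a - sexticField coeffP b‖ ≤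
        K * max ‖a‖ ‖b‖ ^ 4 * ‖a - b‖) ∧
      (∀ a b : PhaseSpace ρ, ‖sexticField coeffZ a - sexticField coeffZ b‖ ≤
        K * max ‖a‖ ‖b‖ ^ 4 * ‖a - b‖) := by
    obtain ⟨K₁, h₁, hK₁⟩ := exists_lipschitz_sexticField hρ enorm_coeffChi_le
    obtain ⟨K₂, h₂, hK₂⟩ := exists_lipschitz_sexticField hρ enorm_coeffP_le
    obtain ⟨K₃, h₃, hK₃⟩ := exists_lipschitz_sexticField hρ enorm_coeffZ_le
    refine ⟨K₁ + K₂ + K₃, by positivity, fun a b => (hK₁ a b).trans ?_,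
      fun a b => (hK₂ a b).trans ?_, fun a b => (hK₃ a b).trans ?_⟩ <;> gcongr <;> linarith
  set X : PhaseSpace ρ → PhaseSpace ρ := sexticField coeffChi
  set XP : PhaseSpace ρ → PhaseSpace ρ := sexticField coeffP
  set XZ : PhaseSpace ρ → PhaseSpace ρ := sexticField coeffZ
  have hXc : ContDiff ℂ ∞ X := contDiff_sexticField hρ enorm_coeffChi_le
  have hXd : Differentiable ℂ X := hXc.differentiable (by simp)
  have hX0 : X 0 = 0 := sexticField_zero
  have hquint : ∀ {F : PhaseSpace ρ → PhaseSpace ρ}, F 0 = 0 →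
      (∀ a b, ‖F a - F b‖ ≤ K * max ‖a‖ ‖b‖ ^ 4 * ‖a - b‖) → ∀ {x : PhaseSpace ρ} {t : ℝ},
      ‖x‖ ≤ t → ‖F x‖ ≤ K * t ^ 5 := fun {F} hF0 hF {x t} hx => by
    have h := hF x 0
    rw [hF0, sub_zero, sub_zero, norm_zero, max_eq_left (norm_nonneg x), mul_assoc,
      ← pow_succ] at h
    exact h.trans (by gcongr)
  have hquart : ∀ m, ‖fderiv ℂ X m‖ ≤ K * ‖m‖ ^ 4 := norm_fderiv_le_of_lipschitz hXd hK0 hKX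
  have hskew : ∀ m u v, symp hρ (fderiv ℂ X m u) v = -symp hρ u (fderiv ℂ X m v) :=
    symp_fderiv_sexticField hρ enorm_coeffChi_le
  have hP : ∀ z, HasFDerivAt hamP ((symp hρ).flip (XP z)) z := fun z => by
    rw [hamP_eq_sextic]
    exact hasFDerivAt_sextic hρ enorm_coeffP_le z
  have hZ : ∀ z, HasFDerivAt hamZ6 ((symp hρ).flip (XZ z)) z := fun z => by
    rw [hamZ6_eq_sextic]
    exact hasFDerivAt_sextic hρ enorm_coeffZ_le z
  have hPc : ContDiff ℂ ∞ (hamP (ρ := ρ)) := by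
    rw [hamP_eq_sextic]
    exact contDiff_sextic hρ enorm_coeffP_le
  have hZc : ContDiff ℂ ∞ (hamZ6 (ρ := ρ)) := by
    rw [hamZ6_eq_sextic]
    exact contDiff_sextic hρ enorm_coeffZ_le
  obtain ⟨δ, hδ0, hδ1, hδ⟩ := exists_midpointMap (ρ := ρ) hρ enorm_coeffChi_le
  refine ⟨δ, hδ0, 2000 * K ^ 2 + 32 * K, fun ε hε hε0 => ?_⟩
  obtain ⟨τ, μ, hsrc, htgt, hτc, hτsc, hτm, hμ⟩ := hδ ε hε hε0
  have hr1 : ∀ z ∈ Metric.ball (0 : PhaseSpace ρ) ε, ‖z‖ ≤ 1 := fun z hz =>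
    (mem_ball_zero_iff.1 hz).le.trans (hε0.trans hδ1)
  have hXμ : ∀ z ∈ Metric.ball (0 : PhaseSpace ρ) ε, ‖X (μ z)‖ ≤ 32 * K * ‖z‖ ^ 5 := fun z hz => by
    refine (hquint hX0 hKX (hμ z hz).2.1).trans (le_of_eq ?_)
    ring
  have hτz : ∀ z ∈ Metric.ball (0 : PhaseSpace ρ) ε, τ z - z = X (μ z) := fun z hz => by
    have h : (1 / 2 : ℂ) • X (μ z) + (1 / 2 : ℂ) • X (μ z) = X (μ z) := by
      rw [← add_smul]
      norm_num
    nth_rewrite 2 [(hμ z hz).1]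
    rw [hτm, add_sub_sub_cancel, h]
  have hJp : ∀ z ∈ Metric.ball (0 : PhaseSpace ρ) ε, ∃ Jp : PhaseSpace ρ ≃L[ℂ] PhaseSpace ρ,
      ∀ v, Jp v = v + (1 / 2 : ℂ) • fderiv ℂ X (μ z) v := fun z hz => by
    refine exists_equiv_of_norm_le (T := (1 / 2 : ℂ) • fderiv ℂ X (μ z)) ?_
    have h1 := (hμ z hz).2.2.2.2.2.1
    have h2 : ‖(1 / 2 : ℂ)‖ = 1 / 2 := by norm_num
    rw [norm_smul, h2]
    linarith
  have hdτ : ∀ z ∈ Metric.ball (0 : PhaseSpace ρ) ε, ∀ {Jp Jm : PhaseSpace ρ ≃L[ℂ] PhaseSpace ρ},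
      (∀ v, Jp v = v + (1 / 2 : ℂ) • fderiv ℂ X (μ z) v) →
      HasFDerivAt μ (Jm.symm : PhaseSpace ρ →L[ℂ] PhaseSpace ρ) z →
      HasFDerivAt τ ((Jp : PhaseSpace ρ →L[ℂ] PhaseSpace ρ).comp
        (Jm.symm : PhaseSpace ρ →L[ℂ] PhaseSpace ρ)) z := fun z hz {Jp Jm} hJp hJm => by
    have h := hJm.fun_add (((hXd (μ z)).hasFDerivAt.comp z hJm).fun_const_smul (1 / 2 : ℂ))
    rw [show ⇑τ = fun z => μ z + (1 / 2 : ℂ) • X (μ z) from funext hτm]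
    refine h.congr_fderiv (ContinuousLinearMap.ext fun v => ?_)
    exact (hJp _).symm
  have hrem : ∀ z ∈ Metric.ball (0 : PhaseSpace ρ) ε, ∃ Y : PhaseSpace ρ,
      ‖Y‖ ≤ (2000 * K ^ 2 + 32 * K) * ‖z‖ ^ 9 ∧
      HasFDerivAt (fun z => hamZ6 (μ z) - hamZ6 z + (hamP (τ z) - hamP (μ z)))
        ((symp hρ).flip Y) z := by
    intro z hz
    obtain ⟨hz1, hμz, hτn, -, -, hA, Jm, hJm, hJmd⟩ := hμ z hz
    obtain ⟨Jp, hJp⟩ := hJp z hz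
    have hr0 := norm_nonneg z
    have hhalf : ‖(1 / 2 : ℂ) • X (μ z)‖ ≤ 16 * K * ‖z‖ ^ 5 := by
      have h2 : ‖(1 / 2 : ℂ)‖ = 1 / 2 := by norm_num
      rw [norm_smul, h2]
      linarith [hXμ z hz]
    have hdist : ∀ {a b : PhaseSpace ρ} {F : PhaseSpace ρ → PhaseSpace ρ},
        (∀ a b, ‖F a - F b‖ ≤ K * max ‖a‖ ‖b‖ ^ 4 * ‖a - b‖) → ‖a‖ ≤ 2 * ‖z‖ → ‖b‖ ≤ 2 * ‖z‖ →
        a - b = (1 / 2 : ℂ) • X (μ z) → ‖F a - F b‖ ≤ 256 * K ^ 2 * ‖z‖ ^ 9 := by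
      intro a b F hF ha hb hab
      calc ‖F a - F b‖ ≤ K * max ‖a‖ ‖b‖ ^ 4 * ‖a - b‖ := hF a b
        _ ≤ K * (2 * ‖z‖) ^ 4 * (16 * K * ‖z‖ ^ 5) := by
          rw [hab]
          gcongr
          exact max_le ha hb
        _ = 256 * K ^ 2 * ‖z‖ ^ 9 := by ring
    have hz2 : ‖z‖ ≤ 2 * ‖z‖ := by linarith
    obtain ⟨Y, hY, hYv⟩ := exists_remainder_vector hρ (hskew (μ z)) hJp hJm hA
      (B := K * (2 * ‖z‖) ^ 4) (D := K * (2 * ‖z‖) ^ 5) (L := 256 * K ^ 2 * ‖z‖ ^ 9)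
      (zZ := XZ z) (mZ := XZ (μ z)) (mP := XP (μ z)) (wP := XP (τ z))
      ((hquart (μ z)).trans (by gcongr)) (hquint sexticField_zero hKZ hz2)
      (hquint sexticField_zero hKP hτn)
      (hdist hKZ hμz hz2 (by nth_rewrite 2 [hz1]; abel))
      (hdist hKP hτn hμz (by rw [hτm]; abel))
    refine ⟨Y, hY.trans ?_, ?_⟩
    · have h : 0 ≤ K * ‖z‖ ^ 9 := by positivity
      have h' : 0 ≤ K ^ 2 * ‖z‖ ^ 9 := by positivity
      nlinarith
    · have h := (((hZ (μ z)).comp z hJmd).sub (hZ z)).add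
        (((hP (τ z)).comp z (hdτ z hz hJp hJmd)).sub ((hP (μ z)).comp z hJmd))
      refine h.congr_fderiv (ContinuousLinearMap.ext fun v => ?_)
      exact (hYv v).symm
  choose! Y hY hYd using hrem
  refine ⟨τ, fun z => hamZ6 (μ z) - hamZ6 z + (hamP (τ z) - hamP (μ z)), Y,
    ⟨hsrc, htgt, hτc, hτsc, fun z hz u v => ?_⟩, fun z hz hE => ?_, fun z hz => ?_,
    isHamiltonianVectorField_of_symp hρ hYd, hY, fun z hz => ?_⟩
  · rw [hsrc] at hz
    obtain ⟨-, -, -, -, -, -, Jm, hJm, hJmd⟩ := hμ z hz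
    obtain ⟨Jp, hJp⟩ := hJp z hz
    rw [(hdτ z hz hJp hJmd).fderiv, ← symp_apply hρ, ← symp_apply hρ]
    show symp hρ (Jp (Jm.symm u)) (Jp (Jm.symm v)) = _
    -- `1 + A / 2` and `1 - A / 2` are adjoint to each other and commute
    have hcomm : ∀ x, Jm (Jp x) = Jp (Jm x) := fun x => by
      simp only [hJp, hJm, map_add, map_smul, smul_add, smul_smul, mul_comm]
      abel
    have h1 : ∀ a b, symp hρ (Jm a) b = symp hρ a (Jp b) := fun a b => by
      rw [hJm, hJp, symp_adjoint hρ (hskew (μ z))]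
    have h2 : ∀ a b, symp hρ (Jp a) b = symp hρ a (Jm b) := fun a b => by
      rw [hJm, hJp, ← symp_adjoint hρ (hskew (μ z)), neg_neg]
    rw [← h1, hcomm, h2, Jm.apply_symm_apply, Jm.apply_symm_apply]
  · obtain ⟨hz1, -, -, hEμ, -⟩ := hμ z hz
    have hm := hEμ hE
    have hτE : FiniteEnergy (τ z) := by
      rw [← sub_add_cancel (τ z) z, hτz z hz]
      exact (hm.sexticField hρ enorm_coeffChi_le).add hE
    refine ⟨hτE, ?_⟩
    have hN := hamN_sub_hamN (m := μ z) (x := X (μ z)) (by rw [← hτm]; exact hτE)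
      (by rw [← hz1]; exact hE)
    rw [← hτm, ← hz1, tsum_pairing_sexticField_coeffChi hρ hm] at hN
    rw [hamH]
    linear_combination hN
  · obtain ⟨-, -, -, -, hμc, -⟩ := hμ z hz
    have hτc' : ContDiffAt ℂ ∞ τ z :=
      (hτc z (hsrc ▸ hz)).contDiffAt (τ.open_source.mem_nhds (hsrc ▸ hz))
    exact (((hZc.contDiffAt.comp z hμc).sub hZc.contDiffAt).add
      ((hPc.contDiffAt.comp z hτc').sub (hPc.contDiffAt.comp z hμc))).contDiffWithinAt
  · rw [hτz z hz]
    refine (hXμ z hz).trans ?_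
    have h1 : ‖z‖ ^ 5 ≤ ‖z‖ ^ 2 := pow_le_pow_of_le_one (norm_nonneg z) (hr1 z hz) (by norm_num)
    have h2 : 0 ≤ 2000 * K ^ 2 * ‖z‖ ^ 2 := by positivity
    nlinarith
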